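/- Let $n\ge 1$ and $n-1<p<n$. There is a constant $C>0$, depending only on $n$ and $p$, with the following property. Let $\Omega\subset\mathbb{R}^n$ be an open (non-degenerate, axis-parallel) cube, let $\lambda>0$, and let $f\colon\Omega\to\mathbb{R}^n$ be a continuous mapping in $W^{1,1}(\Omega,\mathbb{R}^n)$ with weak differential $Df$ such that $$|Df|^n\log^\lambda(e+|Df|)\in L^1(\Omega),$$ where $|Df|$ is the operator norm. Suppose that $f$ is monotone, that is, each component $f_i$ satisfies $\sup_{\partial B}f_i=\sup_B f_i$ and $\inf_{\partial B}f_i=\inf_B f_i$ for every ball $B$ with $\overline B\subset\Omega$. For a non-negative measurable $h$ on $\Omega$ let $\mathcal M_\Omega h(x)=\sup\frac1{|Q|}\int_Q h$, the supremum being taken over all open axis-parallel cubes $Q\subset\Omega$ with $x\in Q$. Then there is a function $\rho\colon\Omega\to[0,\infty)$ such that $\rho = C\,\bigl(\mathcal M_\Omega(|Df|^p)\bigr)^{n/p}$ almost everywhere in $\Omega$, $$\rho\in L^1(\Omega),\qquad \rho\log^\lambda(e+\rho)\in L^1(\Omega),$$ and $$\bigl(\operatorname{diam} f(B(x,r))\bigr)^n\le\int_{B(x,r)}\rho$$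 for all $x\in\Omega$ and $r>0$ such that the closed ball $\overline{B}(x,4\sqrt n\,r)$ is contained in $\Omega$. -/

import Mathlib

open MeasureTheory Set
open scoped ENNReal ContDiff

/-- The open axis-parallel cube with lower corner `a` and side length `s`
(non-degenerate when `0 < s`). -/
def openCube {n : ℕ} (a : EuclideanSpace ℝ (Fin n)) (s : ℝ) : Set (EuclideanSpace ℝ (Fin n)) :=
  {x | ∀ i, a i < x i ∧ x i < a i + s}

/-- A real function is monotone on `Ω` (in the sense of Lebesgue) if on every ball that is contained
in `Ω` together with its boundary sphere, it has the same supremum and the same infimum over the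
ball as over the sphere. The suprema and infima are taken in the extended reals. -/
def LebesgueMonotoneOn {n : ℕ} (u : EuclideanSpace ℝ (Fin n) → ℝ)
    (Ω : Set (EuclideanSpace ℝ (Fin n))) : Prop :=
  ∀ (x : EuclideanSpace ℝ (Fin n)) (r : ℝ), 0 < r → Metric.closedBall x r ⊆ Ω →
    (⨆ y ∈ Metric.sphere x r, (u y : EReal)) = (⨆ y ∈ Metric.ball x r, (u y : EReal)) ∧
    (⨅ y ∈ Metric.sphere x r, (u y : EReal)) = (⨅ y ∈ Metric.ball x r, (u y : EReal))

/-- A mapping is monotone on `Ω` if all its component functions are. -/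
def MapLebesgueMonotoneOn {n : ℕ} (f : EuclideanSpace ℝ (Fin n) → EuclideanSpace ℝ (Fin n))
    (Ω : Set (EuclideanSpace ℝ (Fin n))) : Prop :=
  ∀ i : Fin n, LebesgueMonotoneOn (fun x => f x i) Ω

/-- `f` belongs to the Sobolev space `W^{1,1}(Ω, ℝⁿ)` and `Df` is (a representative of) its weak
differential: both are integrable on `Ω`, and integration by parts holds in every direction `v`
against every smooth test function `φ` compactly supported in `Ω`. -/
structure IsW11WithDeriv {n : ℕ} (f : EuclideanSpace ℝ (Fin n) → EuclideanSpace ℝ (Fin n))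
    (Df : EuclideanSpace ℝ (Fin n) → EuclideanSpace ℝ (Fin n) →L[ℝ] EuclideanSpace ℝ (Fin n))
    (Ω : Set (EuclideanSpace ℝ (Fin n))) : Prop where
  integrable : IntegrableOn f Ω
  integrable_deriv : IntegrableOn Df Ω
  integral_by_parts : ∀ φ : EuclideanSpace ℝ (Fin n) → ℝ,
    ContDiff ℝ ∞ φ → HasCompactSupport φ → tsupport φ ⊆ Ω →
    ∀ v : EuclideanSpace ℝ (Fin n),
      ∫ x in Ω, (fderiv ℝ φ x v) • f x = - ∫ x in Ω, φ x • Df x v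

/-- The maximal operator of `Ω`: the supremum of the averages of `h` over all open cubes
contained in `Ω` that contain the point `x`. -/
noncomputable def cubeMaximal {n : ℕ} (Ω : Set (EuclideanSpace ℝ (Fin n)))
    (h : EuclideanSpace ℝ (Fin n) → ℝ≥0∞) (x : EuclideanSpace ℝ (Fin n)) : ℝ≥0∞ :=
  ⨆ (b : EuclideanSpace ℝ (Fin n)) (t : ℝ) (_ : 0 < t) (_ : x ∈ openCube b t)
    (_ : openCube b t ⊆ Ω), laverage (volume.restrict (openCube b t)) h

/-!
The function `ρ` is the multiple `C * M ^ (n / p)` of a power of the maximal function `M` of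
`‖Df‖ ^ p`, and two independent facts make it work.

*Integrability.* Since `n / p > 1`, the maximal operator is bounded on the Orlicz classes with Young
function `t ^ (n / p) * Ψ t`, `Ψ` increasing (`lintegral_cubeMaximal_rpow_mul_le`). This follows from
the weak type `(1,1)` inequality, a consequence of the Vitali covering lemma, by integrating over the
levels. The choice of `Ψ` as a power of the logarithm gives `ρ log ^ lam (e + ρ) ∈ L¹`.

*The diameter estimate.* Let `n ≥ 2`. By monotonicity the oscillation of a component of `f` on
`B(x₀, r)` is at most the oscillation of `f` on every concentric sphere of radius `t ∈ (r, 2r)`. As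
`p > n - 1`, the Sobolev embedding on spheres bounds the `p`-th power of the latter by the
`p`-energy on the sphere; integrating over `t` yields
`diam f(B(x₀, r)) ^ p ≤ K r ^ (p - n) ∫_{B(x₀, 3r)} ‖Df‖ ^ p` (`exists_ofReal_sub_rpow_le`). The
right side is `K' r ^ p` times at most the mean of `‖Df‖ ^ p` over a cube containing `B(x₀, r)`, hence
at most `K' r ^ p * M y` for every `y ∈ B(x₀, r)`, and it remains to raise to the power `n / p` and
integrate over `y`.

The Sobolev embedding is needed only for smooth maps, since mollification preserves the energy up to
a small enlargement of the ball and a continuous map is approximated uniformly. It is proved without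
calculus on the sphere (`exists_enorm_sub_rpow_le_sphere`): the restriction of a map to a sphere is
extended to be constant on rays, and two points of the sphere are joined through the points of a
ball. A point `y` of the sphere may be replaced by any `s y`, `s ∈ [1, 2]`, and averaging also over
`s` lowers the singularity of the resulting Riesz potential from `τ ^ (-n)` to `τ ^ (1 - n)`; this is
what lowers the condition on the exponent from `p > n` to `p > n - 1`.

For `n = 1` the exponent `p` is below one and the argument is different: a ball is an interval,
so the diameter is at most the integral of `‖Df‖` by the fundamental theorem of calculus, and
`‖Df‖ ≤ M ^ (1 / p)` almost everywhere by the Lebesgue differentiation theorem.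
-/

/-! ### Cubes -/

theorem isOpen_openCube {n : ℕ} (a : EuclideanSpace ℝ (Fin n)) (s : ℝ) : IsOpen (openCube a s) := by
  have : openCube a s = ⋂ i, {x | a i < x i ∧ x i < a i + s} := by
    ext x; simp [openCube]
  rw [this]
  refine isOpen_iInter_of_finite fun i => ?_
  have hc : Continuous fun x : EuclideanSpace ℝ (Fin n) => x i := by fun_prop
  exact (isOpen_lt continuous_const hc).inter (isOpen_lt hc continuous_const)

theorem volume_openCube {n : ℕ} (a : EuclideanSpace ℝ (Fin n)) (s : ℝ) :
    volume (openCube a s) = ENNReal.ofReal s ^ n := by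
  have h := (EuclideanSpace.volume_preserving_symm_measurableEquiv_toLp (Fin n)).measure_preimage
    (MeasurableSet.univ_pi (fun i => measurableSet_Ioo (a := a i) (b := a i + s))).nullMeasurableSet
  rw [Real.volume_pi_Ioo] at h
  simp only [add_sub_cancel_left, Finset.prod_const, Finset.card_univ, Fintype.card_fin] at h
  rw [← h]
  congr 1
  ext x
  simp [openCube, Set.mem_pi]

theorem openCube_nonempty {n : ℕ} (a : EuclideanSpace ℝ (Fin n)) {s : ℝ} (hs : 0 < s) :
    (openCube a s).Nonempty :=
  ⟨WithLp.toLp 2 fun i => a i + s / 2, fun i => by simp only; constructor <;> linarith⟩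

/-- A cube meeting another cube of at least half its side lies in the fivefold concentric
enlargement of the latter. -/
theorem openCube_subset_enlargement {n : ℕ} {b c : EuclideanSpace ℝ (Fin n)} {t u : ℝ}
    (hne : (openCube b t ∩ openCube c u).Nonempty) (htu : t ≤ 2 * u) :
    openCube b t ⊆ openCube (WithLp.toLp 2 fun i => c i - 2 * u) (5 * u) := by
  obtain ⟨z, hz, hz'⟩ := hne
  intro x hx i
  have h1 := hx i
  have h2 := hz i
  have h3 := hz' i
  simp only
  constructor <;> linarith

/-! ### The maximal operator -/

theorem lt_cubeMaximal_iff {n : ℕ} {Ω : Set (EuclideanSpace ℝ (Fin n))}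
    {h : EuclideanSpace ℝ (Fin n) → ℝ≥0∞} {x : EuclideanSpace ℝ (Fin n)} {c : ℝ≥0∞} :
    c < cubeMaximal Ω h x ↔ ∃ (b : EuclideanSpace ℝ (Fin n)) (t : ℝ), 0 < t ∧ x ∈ openCube b t ∧
      openCube b t ⊆ Ω ∧ c < (∫⁻ y in openCube b t, h y) / ENNReal.ofReal t ^ n := by
  unfold cubeMaximal
  simp only [lt_iSup_iff, setLAverage_eq, volume_openCube, exists_prop]

theorem le_cubeMaximal {n : ℕ} {Ω : Set (EuclideanSpace ℝ (Fin n))}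
    {h : EuclideanSpace ℝ (Fin n) → ℝ≥0∞} {x b : EuclideanSpace ℝ (Fin n)} {t : ℝ} (ht : 0 < t)
    (hx : x ∈ openCube b t) (hb : openCube b t ⊆ Ω) :
    (∫⁻ y in openCube b t, h y) / ENNReal.ofReal t ^ n ≤ cubeMaximal Ω h x := by
  by_contra hc
  push Not at hc
  exact lt_irrefl _ (lt_cubeMaximal_iff.2 ⟨b, t, ht, hx, hb, hc⟩)

/-- The maximal function depends only on the almost everywhere class of `h` on `Ω`, which allows
a weak derivative to be replaced by a measurable representative. -/
theorem cubeMaximal_congr {n : ℕ} {Ω : Set (EuclideanSpace ℝ (Fin n))}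
    {h h' : EuclideanSpace ℝ (Fin n) → ℝ≥0∞} (hh : h =ᵐ[volume.restrict Ω] h') :
    cubeMaximal Ω h = cubeMaximal Ω h' := by
  funext x
  unfold cubeMaximal
  refine iSup_congr fun b => iSup_congr fun t => iSup_congr fun _ => iSup_congr fun _ =>
    iSup_congr fun hb => ?_
  simp only [setLAverage_eq]
  rw [lintegral_congr_ae (ae_restrict_of_ae_restrict_of_subset hb hh)]

theorem isOpen_lt_cubeMaximal {n : ℕ} (Ω : Set (EuclideanSpace ℝ (Fin n)))
    (h : EuclideanSpace ℝ (Fin n) → ℝ≥0∞) (c : ℝ≥0∞) : IsOpen {x | c < cubeMaximal Ω h x} := by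
  have : {x | c < cubeMaximal Ω h x} = ⋃ (b : EuclideanSpace ℝ (Fin n)) (t : ℝ)
      (_ : 0 < t ∧ openCube b t ⊆ Ω ∧ c < (∫⁻ y in openCube b t, h y) / ENNReal.ofReal t ^ n),
      openCube b t := by
    ext x
    simp only [mem_ofPred_eq, lt_cubeMaximal_iff, mem_iUnion, exists_prop]
    constructor
    · rintro ⟨b, t, h1, h2, h3, h4⟩; exact ⟨b, t, ⟨h1, h3, h4⟩, h2⟩
    · rintro ⟨b, t, ⟨h1, h3, h4⟩, h2⟩; exact ⟨b, t, h1, h2, h3, h4⟩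
  rw [this]
  exact isOpen_iUnion fun b => isOpen_iUnion fun t => isOpen_iUnion fun _ => isOpen_openCube b t

theorem measurable_cubeMaximal {n : ℕ} (Ω : Set (EuclideanSpace ℝ (Fin n)))
    (h : EuclideanSpace ℝ (Fin n) → ℝ≥0∞) : Measurable (cubeMaximal Ω h) :=
  measurable_of_Ioi fun c => (isOpen_lt_cubeMaximal Ω h c).measurableSet

/-- The weak type `(1,1)` inequality, in the form in which only the part of `h` above the
level matters. -/
theorem volume_lt_cubeMaximal_le {n : ℕ} (hn : n ≠ 0) {Ω : Set (EuclideanSpace ℝ (Fin n))}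
    (hΩ : volume Ω ≠ ⊤)
    {h : EuclideanSpace ℝ (Fin n) → ℝ≥0∞} (hm : Measurable h) (s : ℝ) :
    ENNReal.ofReal s * volume {x | ENNReal.ofReal (2 * s) < cubeMaximal Ω h x} ≤
      5 ^ n * ∫⁻ x in Ω ∩ {x | ENNReal.ofReal s < h x}, h x := by
  set A : Set (EuclideanSpace ℝ (Fin n)) := {x | ENNReal.ofReal s < h x} with hA
  have hAm : MeasurableSet A := measurableSet_lt measurable_const hm
  set T : Set (EuclideanSpace ℝ (Fin n) × ℝ) := {q | 0 < q.2 ∧ openCube q.1 q.2 ⊆ Ω ∧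
    ENNReal.ofReal s * volume (openCube q.1 q.2) ≤ ∫⁻ y in openCube q.1 q.2 ∩ A, h y} with hT
  have hcover : {x | ENNReal.ofReal (2 * s) < cubeMaximal Ω h x} ⊆
      ⋃ q ∈ T, openCube q.1 q.2 := by
    intro x hx
    obtain ⟨b, t, ht, hxb, hb, hlt⟩ := lt_cubeMaximal_iff.1 hx
    refine mem_biUnion (x := (b, t)) ⟨ht, hb, ?_⟩ hxb
    simp only
    set V := volume (openCube b t) with hV
    have hV' : V = ENNReal.ofReal t ^ n := volume_openCube b t
    have hVtop : ENNReal.ofReal s * V ≠ ⊤ := by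
      rw [hV']; exact ENNReal.mul_ne_top ENNReal.ofReal_ne_top (by simp)
    have h1 : ENNReal.ofReal s * V + ENNReal.ofReal s * V ≤ ∫⁻ y in openCube b t, h y := by
      rw [ENNReal.lt_div_iff_mul_lt (by left; positivity) (by left; simp), ← hV'] at hlt
      refine le_trans (le_of_eq ?_) hlt.le
      rw [ENNReal.ofReal_mul (by norm_num)]
      simp; ring
    have h2 : ∫⁻ y in openCube b t, h y ≤
        (∫⁻ y in openCube b t ∩ A, h y) + ENNReal.ofReal s * V := by
      rw [← lintegral_inter_add_sdiff h (openCube b t) hAm]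
      gcongr
      calc ∫⁻ y in openCube b t \ A, h y ≤ ∫⁻ y in openCube b t \ A, ENNReal.ofReal s := by
            refine setLIntegral_mono' ((isOpen_openCube b t).measurableSet.diff hAm) ?_
            intro y hy
            exact not_lt.1 hy.2
        _ ≤ ENNReal.ofReal s * V := by
            rw [setLIntegral_const]
            gcongr ENNReal.ofReal s * ?_
            exact measure_mono sdiff_subset
    exact (ENNReal.add_le_add_iff_right hVtop).1 (h1.trans h2)
  have hbdd : ∃ R : ℝ, ∀ q ∈ T, q.2 ≤ R := by
    refine ⟨max 1 (volume Ω).toReal, fun q hq => ?_⟩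
    by_contra! hc
    have h1 : 1 < q.2 := (le_max_left _ _).trans_lt hc
    have h2 : ENNReal.ofReal q.2 ^ n ≤ volume Ω := by
      rw [← volume_openCube q.1]; exact measure_mono hq.2.1
    have h3 : q.2 ^ n ≤ (volume Ω).toReal := by
      rw [← ENNReal.ofReal_le_iff_le_toReal hΩ, ENNReal.ofReal_pow (by linarith)]; exact h2
    have h4 : q.2 ≤ q.2 ^ n := le_self_pow₀ h1.le hn
    linarith [le_max_right 1 (volume Ω).toReal]
  obtain ⟨R, hR⟩ := hbdd
  obtain ⟨u, huT, hdisj, hu⟩ := Vitali.exists_disjoint_subfamily_covering_enlargement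
    (fun q : EuclideanSpace ℝ (Fin n) × ℝ => openCube q.1 q.2) T (fun q => q.2) 2 (by norm_num)
    (fun q hq => hq.1.le) R hR (fun q hq => openCube_nonempty _ hq.1)
  have hcount : u.Countable := hdisj.countable_of_isOpen (fun q _ => isOpen_openCube _ _)
    (fun q hq => openCube_nonempty _ (huT hq).1)
  have hcover2 : {x | ENNReal.ofReal (2 * s) < cubeMaximal Ω h x} ⊆
      ⋃ q ∈ u, openCube (WithLp.toLp 2 fun i => q.1 i - 2 * q.2) (5 * q.2) := by
    intro x hx
    obtain ⟨q, hq, hxq⟩ := mem_iUnion₂.1 (hcover hx)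
    obtain ⟨q', hq', hne, hle⟩ := hu q hq
    exact mem_biUnion hq' (openCube_subset_enlargement hne hle hxq)
  calc ENNReal.ofReal s * volume {x | ENNReal.ofReal (2 * s) < cubeMaximal Ω h x}
      ≤ ENNReal.ofReal s * ∑' q : u, volume
          (openCube (WithLp.toLp 2 fun i => q.1.1 i - 2 * q.1.2) (5 * q.1.2)) := by
        gcongr
        exact (measure_mono hcover2).trans (measure_biUnion_le _ hcount _)
    _ = 5 ^ n * ∑' q : u, ENNReal.ofReal s * volume (openCube q.1.1 q.1.2) := by
        rw [ENNReal.tsum_mul_left, mul_left_comm]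
        congr 1
        rw [← ENNReal.tsum_mul_left]
        congr 1
        funext q
        rw [volume_openCube, volume_openCube, ENNReal.ofReal_mul (by norm_num), mul_pow]
        simp
    _ ≤ 5 ^ n * ∑' q : u, ∫⁻ y in openCube q.1.1 q.1.2 ∩ A, h y := by
        gcongr with q
        exact (huT q.2).2.2
    _ = 5 ^ n * ∫⁻ y in ⋃ q ∈ u, openCube q.1 q.2 ∩ A, h y := by
        rw [lintegral_biUnion hcount
          (fun q _ => (isOpen_openCube _ _).measurableSet.inter hAm)]
        exact fun q hq q' hq' hne => (hdisj hq hq' hne).mono inter_subset_left inter_subset_left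
    _ ≤ 5 ^ n * ∫⁻ y in Ω ∩ A, h y := by
        gcongr
        exact iUnion₂_subset fun q hq => inter_subset_inter_left _ (huT hq).2.1

theorem ae_cubeMaximal_lt_top {n : ℕ} (hn : n ≠ 0) {Ω : Set (EuclideanSpace ℝ (Fin n))}
    (hΩ : volume Ω ≠ ⊤)
    {h : EuclideanSpace ℝ (Fin n) → ℝ≥0∞} (hm : Measurable h) (hi : ∫⁻ x in Ω, h x ≠ ⊤) :
    ∀ᵐ x, cubeMaximal Ω h x < ⊤ := by
  rw [ae_iff]
  by_contra hpos
  set v := volume {x | ¬ cubeMaximal Ω h x < ⊤} with hv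
  set I := ∫⁻ x in Ω, h x with hI
  have key : ∀ s : ℝ, 0 < s → ENNReal.ofReal s * v ≤ 5 ^ n * I := by
    intro s hs
    calc ENNReal.ofReal s * v
        ≤ ENNReal.ofReal s * volume {x | ENNReal.ofReal (2 * s) < cubeMaximal Ω h x} := by
          gcongr ENNReal.ofReal s * ?_
          refine measure_mono fun x hx => ?_
          simp only [mem_ofPred_eq, not_lt, top_le_iff] at hx ⊢
          rw [hx]; exact ENNReal.ofReal_lt_top
      _ ≤ _ := volume_lt_cubeMaximal_le hn hΩ hm s
      _ ≤ _ := by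
          gcongr
          exact lintegral_mono_set inter_subset_left
  have hfin : 5 ^ n * I / v ≠ ⊤ := ENNReal.div_ne_top (ENNReal.mul_ne_top (by simp) hi) hpos
  have h1 := key ((5 ^ n * I / v).toReal + 1) (by positivity)
  have hvtop : v ≠ ⊤ := by
    intro hvt
    rw [hvt, ENNReal.mul_top (by simp)] at h1
    exact ENNReal.mul_ne_top (by simp) hi (top_le_iff.1 h1)
  rw [← ENNReal.le_div_iff_mul_le (Or.inl hpos) (Or.inl hvtop),
    ENNReal.ofReal_add ENNReal.toReal_nonneg zero_le_one, ENNReal.ofReal_toReal hfin] at h1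
  simp only [ENNReal.ofReal_one] at h1
  exact absurd h1 (not_le.2 (ENNReal.lt_add_right hfin one_ne_zero))

theorem lintegral_Ioo_rpow {b : ℝ} (hb : 0 ≤ b) {r : ℝ} (hr : -1 < r) :
    ∫⁻ s in Ioo 0 b, ENNReal.ofReal s ^ r = ENNReal.ofReal (b ^ (r + 1) / (r + 1)) := by
  have hint : IntegrableOn (fun s : ℝ => s ^ r) (Ioo 0 b) := by
    have := (intervalIntegral.intervalIntegrable_rpow' (a := 0) (b := b) hr).1
    rw [integrableOn_Ioc_iff_integrableOn_Ioo] at this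
    exact this
  have h1 : ∫ s in Ioo 0 b, s ^ r = b ^ (r + 1) / (r + 1) := by
    rw [← integral_Ioc_eq_integral_Ioo, ← intervalIntegral.integral_of_le hb,
      integral_rpow (Or.inl hr), Real.zero_rpow (by linarith), sub_zero]
  rw [← h1, ofReal_integral_eq_lintegral_ofReal hint]
  · refine setLIntegral_congr_fun measurableSet_Ioo fun s hs => ?_
    exact ENNReal.ofReal_rpow_of_pos hs.1
  · filter_upwards [ae_restrict_mem measurableSet_Ioo] with s hs
    exact Real.rpow_nonneg hs.1.le r

/-- A strong type inequality for the maximal operator between Orlicz classes whose Young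
functions have the form `t ↦ t ^ q * Ψ t` with `q > 1` and `Ψ` increasing. -/
theorem lintegral_cubeMaximal_rpow_mul_le {n : ℕ} (hn : n ≠ 0)
    {Ω : Set (EuclideanSpace ℝ (Fin n))} (hΩ : volume Ω ≠ ⊤)
    {h : EuclideanSpace ℝ (Fin n) → ℝ≥0∞} (hm : Measurable h) (hi : ∫⁻ x in Ω, h x ≠ ⊤)
    {q : ℝ} (hq : 1 < q) {Ψ : ℝ → ℝ≥0∞} (hΨ : Monotone Ψ) :
    ∫⁻ x in Ω, cubeMaximal Ω h x ^ q * Ψ (cubeMaximal Ω h x).toReal ≤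
      ENNReal.ofReal (4 ^ q * 5 ^ n / (q - 1)) *
        ∫⁻ x in Ω, h x ^ q * Ψ (4 * (h x).toReal) := by
  set M := cubeMaximal Ω h with hM
  have hMm : Measurable M := measurable_cubeMaximal Ω h
  have hΨm : Measurable Ψ := hΨ.measurable
  -- Only `s` between `m / 4` and `m / 2` are used, where `m = M x`: there `Ψ (4 * s) ≥ Ψ m`.
  have hpt : ∀ᵐ x ∂(volume.restrict Ω), M x ^ q * Ψ (M x).toReal ≤
      ENNReal.ofReal (4 ^ q) * ∫⁻ s in Ioi (0 : ℝ), {s | ENNReal.ofReal (2 * s) < M x}.indicator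
        (fun s => ENNReal.ofReal s ^ (q - 1) * Ψ (4 * s)) s := by
    filter_upwards [ae_restrict_of_ae (ae_cubeMaximal_lt_top hn hΩ hm hi)] with x hx
    rcases eq_or_ne (M x) 0 with h0 | h0
    · rw [h0, ENNReal.zero_rpow_of_pos (by linarith), zero_mul]; exact zero_le
    set m := (M x).toReal with hmdef
    have hmM : M x = ENNReal.ofReal m := (ENNReal.ofReal_toReal hx.ne).symm
    have hmpos : 0 < m := ENNReal.toReal_pos h0 hx.ne
    calc M x ^ q * Ψ m
        = ENNReal.ofReal (4 ^ q) * ∫⁻ s in Ioo (m / 4) (m / 2),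
            ENNReal.ofReal (m / 4) ^ (q - 1) * Ψ m := by
          rw [setLIntegral_const, Real.volume_Ioo, hmM, ENNReal.ofReal_rpow_of_pos hmpos,
            ENNReal.ofReal_rpow_of_pos (by positivity), mul_right_comm, ← ENNReal.ofReal_mul
            (by positivity), ← mul_assoc, ← ENNReal.ofReal_mul (by positivity)]
          congr 2
          have h1 : m / 2 - m / 4 = m / 4 := by ring
          rw [h1]
          rw [← Real.rpow_add_one (by positivity), sub_add_cancel,
            ← Real.mul_rpow (by norm_num) (by positivity), mul_div_cancel₀ _ (by norm_num)]
      _ ≤ ENNReal.ofReal (4 ^ q) * ∫⁻ s in Ioo (m / 4) (m / 2),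
            {s | ENNReal.ofReal (2 * s) < M x}.indicator
              (fun s => ENNReal.ofReal s ^ (q - 1) * Ψ (4 * s)) s := by
          gcongr 1
          refine setLIntegral_mono' measurableSet_Ioo fun s hs => ?_
          rw [indicator_of_mem]
          · gcongr
            · exact hs.1.le
            · apply hΨ; linarith [hs.1]
          · simp only [mem_ofPred_eq]
            rw [hmM, ENNReal.ofReal_lt_ofReal_iff hmpos]
            linarith [hs.2]
      _ ≤ _ := by
          gcongr 1
          exact lintegral_mono_set fun s hs => by
            have := hs.1; simp only [mem_Ioi]; linarith
  have hmeas1 : Measurable (fun z : EuclideanSpace ℝ (Fin n) × ℝ =>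
      {s | ENNReal.ofReal (2 * s) < M z.1}.indicator
        (fun s => ENNReal.ofReal s ^ (q - 1) * Ψ (4 * s)) z.2) := by
    have : (fun z : EuclideanSpace ℝ (Fin n) × ℝ =>
      {s | ENNReal.ofReal (2 * s) < M z.1}.indicator
        (fun s => ENNReal.ofReal s ^ (q - 1) * Ψ (4 * s)) z.2) =
        {z : EuclideanSpace ℝ (Fin n) × ℝ | ENNReal.ofReal (2 * z.2) < M z.1}.indicator
        (fun z => ENNReal.ofReal z.2 ^ (q - 1) * Ψ (4 * z.2)) := by
      funext z; simp [indicator]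
    rw [this]
    refine Measurable.indicator (by fun_prop) ?_
    exact measurableSet_lt (by fun_prop) (by fun_prop)
  have hmeas2 : Measurable (fun z : EuclideanSpace ℝ (Fin n) × ℝ =>
      {s | ENNReal.ofReal s < h z.1}.indicator
        (fun s => ENNReal.ofReal s ^ (q - 2) * Ψ (4 * s) * h z.1) z.2) := by
    have : (fun z : EuclideanSpace ℝ (Fin n) × ℝ =>
      {s | ENNReal.ofReal s < h z.1}.indicator
        (fun s => ENNReal.ofReal s ^ (q - 2) * Ψ (4 * s) * h z.1) z.2) =
        {z : EuclideanSpace ℝ (Fin n) × ℝ | ENNReal.ofReal z.2 < h z.1}.indicator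
        (fun z => ENNReal.ofReal z.2 ^ (q - 2) * Ψ (4 * z.2) * h z.1) := by
      funext z; simp [indicator]
    rw [this]
    refine Measurable.indicator (by fun_prop) ?_
    exact measurableSet_lt (by fun_prop) (by fun_prop)
  calc ∫⁻ x in Ω, M x ^ q * Ψ (M x).toReal
      ≤ ∫⁻ x in Ω, ENNReal.ofReal (4 ^ q) * ∫⁻ s in Ioi (0 : ℝ),
          {s | ENNReal.ofReal (2 * s) < M x}.indicator
            (fun s => ENNReal.ofReal s ^ (q - 1) * Ψ (4 * s)) s := lintegral_mono_ae hpt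
    _ = ENNReal.ofReal (4 ^ q) * ∫⁻ s in Ioi (0 : ℝ), ∫⁻ x in Ω,
          {s | ENNReal.ofReal (2 * s) < M x}.indicator
            (fun s => ENNReal.ofReal s ^ (q - 1) * Ψ (4 * s)) s := by
        rw [lintegral_const_mul' _ _ ENNReal.ofReal_ne_top, lintegral_lintegral_swap]
        exact hmeas1.aemeasurable
    _ ≤ ENNReal.ofReal (4 ^ q) * ∫⁻ s in Ioi (0 : ℝ), 5 ^ n * ∫⁻ x in Ω,
          {s | ENNReal.ofReal s < h x}.indicator
            (fun s => ENNReal.ofReal s ^ (q - 2) * Ψ (4 * s) * h x) s := by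
        gcongr 1
        refine setLIntegral_mono' measurableSet_Ioi fun s hs => ?_
        have hs : 0 < s := hs
        have hw := volume_lt_cubeMaximal_le (Ω := Ω) hn hΩ hm s
        have hS0 : ENNReal.ofReal s ≠ 0 := by simpa using hs
        set c := ENNReal.ofReal s ^ (q - 2) * Ψ (4 * s) with hc
        have e1 : ∀ x, {s | ENNReal.ofReal (2 * s) < M x}.indicator
            (fun s => ENNReal.ofReal s ^ (q - 1) * Ψ (4 * s)) s =
            {x | ENNReal.ofReal (2 * s) < M x}.indicator
              (fun _ => ENNReal.ofReal s ^ (q - 1) * Ψ (4 * s)) x := by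
          intro x; simp [indicator]
        have e2 : ∀ x, {s | ENNReal.ofReal s < h x}.indicator
            (fun s => ENNReal.ofReal s ^ (q - 2) * Ψ (4 * s) * h x) s =
            {x | ENNReal.ofReal s < h x}.indicator (fun x => c * h x) x := by
          intro x; simp [indicator, hc]
        simp_rw [e1, e2]
        have hAm : MeasurableSet {x | ENNReal.ofReal s < h x} :=
          measurableSet_lt measurable_const hm
        rw [lintegral_indicator_const (isOpen_lt_cubeMaximal Ω h _).measurableSet,
          lintegral_indicator hAm, Measure.restrict_restrict hAm,
          lintegral_const_mul _ hm, inter_comm]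
        have e3 : ENNReal.ofReal s ^ (q - 1) * Ψ (4 * s) = c * ENNReal.ofReal s := by
          have : q - 1 = q - 2 + 1 := by ring
          rw [this, ENNReal.rpow_add _ _ hS0 ENNReal.ofReal_ne_top, ENNReal.rpow_one, hc]
          ring
        rw [e3, mul_assoc, mul_left_comm _ c]
        gcongr c * ?_
        refine le_trans ?_ hw
        gcongr
        exact Measure.restrict_le_self
    _ = ENNReal.ofReal (4 ^ q) * (5 ^ n * ∫⁻ x in Ω, ∫⁻ s in Ioi (0 : ℝ),
          {s | ENNReal.ofReal s < h x}.indicator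
            (fun s => ENNReal.ofReal s ^ (q - 2) * Ψ (4 * s) * h x) s) := by
        rw [lintegral_const_mul' _ _ (by simp), lintegral_lintegral_swap]
        exact (hmeas2.comp measurable_swap).aemeasurable
    _ ≤ ENNReal.ofReal (4 ^ q) * (5 ^ n * ∫⁻ x in Ω, ENNReal.ofReal (1 / (q - 1)) *
          (h x ^ q * Ψ (4 * (h x).toReal))) := by
        gcongr 2
        refine lintegral_mono_ae ?_
        filter_upwards [ae_lt_top hm hi] with x hx
        rcases eq_or_ne (h x) 0 with h0 | h0
        · simp [h0]
        set m := (h x).toReal with hmdef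
        have hmM : h x = ENNReal.ofReal m := (ENNReal.ofReal_toReal hx.ne).symm
        have hmpos : 0 < m := ENNReal.toReal_pos h0 hx.ne
        calc ∫⁻ s in Ioi (0 : ℝ), {s | ENNReal.ofReal s < h x}.indicator
              (fun s => ENNReal.ofReal s ^ (q - 2) * Ψ (4 * s) * h x) s
            ≤ ∫⁻ s in Ioi (0 : ℝ), (Ioo 0 m).indicator
              (fun s => ENNReal.ofReal s ^ (q - 2) * Ψ (4 * m) * h x) s := by
              refine setLIntegral_mono' measurableSet_Ioi fun s hs => ?_
              by_cases hsm : s < m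
              · rw [indicator_of_mem (show s ∈ Ioo 0 m from ⟨hs, hsm⟩)]
                refine (indicator_le_self _ _ _).trans ?_
                gcongr
                apply hΨ; linarith
              · rw [indicator_of_notMem]
                · exact zero_le
                · simp only [mem_ofPred_eq, hmM, not_lt]
                  exact ENNReal.ofReal_le_ofReal (not_lt.1 hsm)
          _ ≤ ∫⁻ s, (Ioo 0 m).indicator
              (fun s => ENNReal.ofReal s ^ (q - 2) * Ψ (4 * m) * h x) s := setLIntegral_le_lintegral _ _
          _ = ENNReal.ofReal (1 / (q - 1)) * (h x ^ q * Ψ (4 * m)) := by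
              rw [lintegral_indicator measurableSet_Ioo, lintegral_mul_const _ (by fun_prop),
                lintegral_mul_const _ (by fun_prop), lintegral_Ioo_rpow hmpos.le (by linarith),
                mul_right_comm, ← mul_assoc]
              congr 1
              rw [hmM, ENNReal.ofReal_rpow_of_pos hmpos, ← ENNReal.ofReal_mul' hmpos.le,
                ← ENNReal.ofReal_mul' (by positivity)]
              congr 1
              have e : q = q - 1 + 1 := by ring
              have e2 : q - 2 + 1 = q - 1 := by ring
              rw [e2]
              conv_rhs => rw [e, Real.rpow_add hmpos, Real.rpow_one]
              ring_nf
    _ = _ := by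
        rw [lintegral_const_mul' _ _ ENNReal.ofReal_ne_top, ← mul_assoc, ← mul_assoc]
        congr 1
        have : (5 : ℝ≥0∞) ^ n = ENNReal.ofReal (5 ^ n) := by
          rw [ENNReal.ofReal_pow (by norm_num)]; simp
        rw [this, ← ENNReal.ofReal_mul (by positivity), ← ENNReal.ofReal_mul (by positivity)]
        congr 1
        ring

/-! ### Oscillation on spheres -/

theorem lintegral_comp_add_smul {n : ℕ} {H : EuclideanSpace ℝ (Fin n) → ℝ≥0∞} (hH : Measurable H)
    (c : EuclideanSpace ℝ (Fin n)) {t : ℝ} (ht : 0 < t) :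
    ∫⁻ w, H (c + t • w) = ENNReal.ofReal (t ^ n)⁻¹ * ∫⁻ z, H z := by
  have h1 : ∫⁻ w, H (c + t • w) =
      ∫⁻ z, H (c + z) ∂(Measure.map (fun w : EuclideanSpace ℝ (Fin n) => t • w) volume) := by
    rw [lintegral_map (by fun_prop) (by fun_prop)]
  rw [h1, Measure.map_addHaar_smul _ ht.ne', lintegral_smul_measure,
    lintegral_add_left_eq_self (μ := volume) H c, finrank_euclideanSpace_fin,
    abs_of_pos (by positivity), smul_eq_mul]

theorem lintegral_rpow_le_measure_univ_mul {α : Type*} [MeasurableSpace α] (μ : Measure α)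
    {p : ℝ} (hp : 1 ≤ p) {f : α → ℝ≥0∞} (hf : AEMeasurable f μ) :
    ∫⁻ x, f x ∂μ ≤ (∫⁻ x, f x ^ p ∂μ) ^ (1 / p) * μ univ ^ (1 - 1 / p) := by
  have := eLpNorm'_le_eLpNorm'_mul_rpow_measure_univ (μ := μ) (f := f) one_pos hp
    hf.aestronglyMeasurable
  simpa [eLpNorm'] using this

/-- The density of the random point `(1 - τ) s y + τ w`, where `s` is uniform in `[1, 2]` and `w`
uniform in a ball, is of order `τ ^ (1 - n)`. The averaging over `s` gains one power of `τ` over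
the bound `τ ^ (-n)` that holds for fixed `s`. -/
theorem lintegral_lintegral_segment_le {n : ℕ} {H : EuclideanSpace ℝ (Fin n) → ℝ≥0∞}
    (hH : Measurable H) {y : EuclideanSpace ℝ (Fin n)} (hy : ‖y‖ = 1)
    (w₀ : EuclideanSpace ℝ (Fin n)) {τ : ℝ} (h0 : 0 < τ) (h1 : τ ≤ 1) :
    ∫⁻ s in Icc (1 : ℝ) 2, ∫⁻ w in Metric.ball w₀ (1 / 4), H (((1 - τ) * s) • y + τ • w) ≤
      ENNReal.ofReal (2 * τ * (τ ^ n)⁻¹) * ∫⁻ z, H z := by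
  set D : Set (ℝ × EuclideanSpace ℝ (Fin n)) :=
    {q | ‖q.2 - ((1 - τ) * q.1) • y - τ • w₀‖ < τ / 4} with hD
  have hDm : MeasurableSet D := (isOpen_lt (by fun_prop) continuous_const).measurableSet
  have inner : ∀ s : ℝ, ∫⁻ w in Metric.ball w₀ (1 / 4), H (((1 - τ) * s) • y + τ • w) =
      ENNReal.ofReal (τ ^ n)⁻¹ * ∫⁻ z, D.indicator (fun q => H q.2) (s, z) := by
    intro s
    rw [← lintegral_comp_add_smul (H := fun z => D.indicator (fun q => H q.2) (s, z))
      ((Measurable.indicator (by fun_prop) hDm).comp measurable_prodMk_left)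
      (((1 - τ) * s) • y) h0, ← lintegral_indicator measurableSet_ball]
    congr 1
    funext w
    have hiff : w ∈ Metric.ball w₀ (1 / 4) ↔ (s, ((1 - τ) * s) • y + τ • w) ∈ D := by
      simp only [hD, mem_ofPred_eq, Metric.mem_ball, dist_eq_norm, add_sub_cancel_left, ← smul_sub,
        norm_smul, Real.norm_of_nonneg h0.le]
      constructor
      · intro h; nlinarith
      · intro h; by_contra! hc; nlinarith
    by_cases hw : w ∈ Metric.ball w₀ (1 / 4)
    · rw [indicator_of_mem hw, indicator_of_mem (hiff.1 hw)]
    · rw [indicator_of_notMem hw, indicator_of_notMem (fun h => hw (hiff.2 h))]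
  -- Two such `s` differ by at most `1`, and `(1 - τ) times the difference is at most τ / 2`, so by at most `2 τ`.
  have hslice : ∀ z : EuclideanSpace ℝ (Fin n),
      volume (Icc (1 : ℝ) 2 ∩ {s | (s, z) ∈ D}) ≤ ENNReal.ofReal (2 * τ) := by
    intro z
    refine (Real.volume_le_diam _).trans (Metric.ediam_le fun s hs s' hs' => ?_)
    rw [edist_dist]
    refine ENNReal.ofReal_le_ofReal ?_
    rw [Real.dist_eq]
    have e1 : |s - s'| ≤ 1 := by
      have := hs.1.1; have := hs.1.2; have := hs'.1.1; have := hs'.1.2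
      rw [abs_le]; constructor <;> linarith
    have e2 : (1 - τ) * |s - s'| ≤ τ / 2 := by
      have a1 : ‖z - ((1 - τ) * s) • y - τ • w₀‖ < τ / 4 := hs.2
      have a2 : ‖z - ((1 - τ) * s') • y - τ • w₀‖ < τ / 4 := hs'.2
      have a3 : ‖((1 - τ) * (s' - s)) • y‖ ≤ τ / 4 + τ / 4 := by
        have : ((1 - τ) * (s' - s)) • y =
          (z - ((1 - τ) * s) • y - τ • w₀) - (z - ((1 - τ) * s') • y - τ • w₀) := by module
        rw [this]
        exact (norm_sub_le _ _).trans (by linarith)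
      rw [norm_smul, hy, mul_one, Real.norm_eq_abs, abs_mul, abs_of_nonneg (by linarith : 0 ≤ 1 - τ),
        abs_sub_comm] at a3
      linarith
    nlinarith [mul_le_mul_of_nonneg_left e1 h0.le]
  have hmeas : Measurable fun q : ℝ × EuclideanSpace ℝ (Fin n) =>
      D.indicator (fun q => H q.2) q := Measurable.indicator (by fun_prop) hDm
  simp_rw [inner]
  rw [lintegral_const_mul' _ _ ENNReal.ofReal_ne_top, lintegral_lintegral_swap
    (by exact hmeas.aemeasurable), mul_comm (2 * τ), ENNReal.ofReal_mul (by positivity), mul_assoc]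
  gcongr
  rw [← lintegral_const_mul _ hH]
  refine lintegral_mono fun z => ?_
  have hsm : MeasurableSet {s : ℝ | (s, z) ∈ D} := measurable_prodMk_right hDm
  have : ∀ s : ℝ, D.indicator (fun q => H q.2) (s, z) =
      {s : ℝ | (s, z) ∈ D}.indicator (fun _ => H z) s := fun s => by simp [indicator]
  simp_rw [this]
  rw [lintegral_indicator_const hsm, Measure.restrict_apply hsm, mul_comm, inter_comm]
  gcongr
  exact hslice z

/-- Averaging `G` over all segments from the points `s y`, `s ∈ [1, 2]`, to the points of a ball
is controlled by the `L^p` norm of `G` as soon as `p > n - 1`. -/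
theorem exists_lintegral_segments_le {n : ℕ} {p : ℝ} (hp1 : 1 ≤ p) (hp : (n : ℝ) - 1 < p) :
    ∃ K : ℝ≥0∞, K ≠ ⊤ ∧ ∀ G : EuclideanSpace ℝ (Fin n) → ℝ≥0∞, Measurable G →
      ∀ y w₀ : EuclideanSpace ℝ (Fin n), ‖y‖ = 1 →
      ∫⁻ s in Icc (1 : ℝ) 2, ∫⁻ w in Metric.ball w₀ (1 / 4), ∫⁻ τ in Icc (0 : ℝ) 1,
        G (((1 - τ) * s) • y + τ • w) ≤ K * (∫⁻ z, G z ^ p) ^ (1 / p) := by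
  have hp0 : 0 < p := by linarith
  have hr : -1 < (1 - n) / p := by
    rw [lt_div_iff₀ hp0]; linarith
  set V : ℝ≥0∞ := volume (Metric.ball (0 : EuclideanSpace ℝ (Fin n)) (1 / 4)) with hV
  have hVt : V ≠ ⊤ := measure_ball_lt_top.ne
  set K : ℝ≥0∞ := V ^ (1 - 1 / p) * ENNReal.ofReal 2 ^ (1 / p) *
    ∫⁻ τ in Ioo (0 : ℝ) 1, ENNReal.ofReal τ ^ ((1 - n) / p) with hK
  refine ⟨K, ?_, fun G hG y w₀ hy => ?_⟩
  · rw [hK, lintegral_Ioo_rpow zero_le_one hr]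
    refine ENNReal.mul_ne_top (ENNReal.mul_ne_top ?_ ?_) ENNReal.ofReal_ne_top
    · exact ENNReal.rpow_ne_top_of_nonneg (by rw [sub_nonneg, div_le_one hp0]; exact hp1) hVt
    · exact ENNReal.rpow_ne_top_of_nonneg (by positivity) ENNReal.ofReal_ne_top
  set μ : Measure (ℝ × EuclideanSpace ℝ (Fin n)) :=
    (volume.restrict (Icc (1 : ℝ) 2)).prod (volume.restrict (Metric.ball w₀ (1 / 4))) with hμ
  have hμu : μ univ = V := by
    rw [hμ, ← univ_prod_univ, Measure.prod_prod]
    simp only [Measure.restrict_apply_univ, Real.volume_Icc, hV]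
    rw [Measure.addHaar_ball_center]
    norm_num
  have hGm : Measurable fun q : (ℝ × EuclideanSpace ℝ (Fin n)) × ℝ =>
      G (((1 - q.2) * q.1.1) • y + q.2 • q.1.2) := hG.comp (by fun_prop)
  calc ∫⁻ s in Icc (1 : ℝ) 2, ∫⁻ w in Metric.ball w₀ (1 / 4), ∫⁻ τ in Icc (0 : ℝ) 1,
        G (((1 - τ) * s) • y + τ • w)
      = ∫⁻ q, (∫⁻ τ in Icc (0 : ℝ) 1, G (((1 - τ) * q.1) • y + τ • q.2)) ∂μ := by
        rw [hμ, lintegral_prod]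
        exact hGm.lintegral_prod_right'.aemeasurable
    _ = ∫⁻ τ in Ioo (0 : ℝ) 1, ∫⁻ q, G (((1 - τ) * q.1) • y + τ • q.2) ∂μ := by
        rw [lintegral_lintegral_swap, restrict_Ioo_eq_restrict_Icc]
        exact hGm.aemeasurable
    _ ≤ ∫⁻ τ in Ioo (0 : ℝ) 1, V ^ (1 - 1 / p) * ENNReal.ofReal 2 ^ (1 / p) *
          (∫⁻ z, G z ^ p) ^ (1 / p) * ENNReal.ofReal τ ^ ((1 - n) / p) := by
        refine setLIntegral_mono' measurableSet_Ioo fun τ hτ => ?_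
        have hm : Measurable fun q : ℝ × EuclideanSpace ℝ (Fin n) =>
          G (((1 - τ) * q.1) • y + τ • q.2) := hG.comp (by fun_prop)
        refine (lintegral_rpow_le_measure_univ_mul μ hp1 hm.aemeasurable).trans ?_
        have hτ0 : ENNReal.ofReal τ ≠ 0 := by simpa using hτ.1
        have e : ENNReal.ofReal (2 * τ * (τ ^ n)⁻¹) =
            ENNReal.ofReal 2 * ENNReal.ofReal τ ^ ((1 : ℝ) - n) := by
          rw [ENNReal.ofReal_rpow_of_pos hτ.1, Real.rpow_sub hτ.1, Real.rpow_one, Real.rpow_natCast,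
            ← ENNReal.ofReal_mul (by norm_num)]
          congr 1
          ring
        calc (∫⁻ q, G (((1 - τ) * q.1) • y + τ • q.2) ^ p ∂μ) ^ (1 / p) * μ univ ^ (1 - 1 / p)
            ≤ (ENNReal.ofReal 2 * ENNReal.ofReal τ ^ ((1 : ℝ) - n) * ∫⁻ z, G z ^ p) ^ (1 / p) *
              V ^ (1 - 1 / p) := by
              rw [hμu]
              gcongr
              rw [hμ, lintegral_prod _ (hm.pow_const p).aemeasurable, ← e]
              exact lintegral_lintegral_segment_le (H := fun z => G z ^ p) (hG.pow_const p) hy w₀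
                hτ.1 hτ.2.le
          _ = _ := by
              rw [ENNReal.mul_rpow_of_nonneg _ _ (by positivity : 0 ≤ 1 / p),
                ENNReal.mul_rpow_of_nonneg _ _ (by positivity : 0 ≤ 1 / p), ← ENNReal.rpow_mul,
                mul_one_div]
              ring
    _ = K * (∫⁻ z, G z ^ p) ^ (1 / p) := by
        rw [lintegral_const_mul _ (by fun_prop), hK]
        ring

/-- The fundamental theorem of calculus along the radial projection to a sphere of a segment. -/
theorem enorm_sub_le_lintegral_radial {n : ℕ}
    {g : EuclideanSpace ℝ (Fin n) → EuclideanSpace ℝ (Fin n)} (hg : ContDiff ℝ 1 g)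
    (x₀ : EuclideanSpace ℝ (Fin n)) {t : ℝ} (ht : 0 < t) {a b : EuclideanSpace ℝ (Fin n)}
    {c : ℝ} (hc : 0 < c) (hab : ∀ τ ∈ Icc (0 : ℝ) 1, c ≤ ‖(1 - τ) • a + τ • b‖) :
    ‖g (x₀ + t • ‖b‖⁻¹ • b) - g (x₀ + t • ‖a‖⁻¹ • a)‖ₑ ≤ ∫⁻ τ in Icc (0 : ℝ) 1,
      ENNReal.ofReal (t * (2 / c) * ‖b - a‖) *
        ‖fderiv ℝ g (x₀ + t • ‖(1 - τ) • a + τ • b‖⁻¹ • ((1 - τ) • a + τ • b))‖ₑ := by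
  set γ : ℝ → EuclideanSpace ℝ (Fin n) := fun τ => (1 - τ) • a + τ • b with hγ
  have hγs : ContDiff ℝ 1 γ := by fun_prop
  have hne : ∀ τ ∈ Icc (0 : ℝ) 1, γ τ ≠ 0 := fun τ hτ h => by
    have := hab τ hτ
    rw [show (1 - τ) • a + τ • b = γ τ from rfl, h, norm_zero] at this
    linarith
  have hφ : ContDiffOn ℝ 1 (fun τ => ‖γ τ‖) (Icc 0 1) := hγs.contDiffOn.norm ℝ hne
  have hP : ContDiffOn ℝ 1 (fun τ => x₀ + t • ‖γ τ‖⁻¹ • γ τ) (Icc 0 1) := by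
    have hi : ContDiffOn ℝ 1 (fun τ => ‖γ τ‖⁻¹) (Icc 0 1) :=
      hφ.inv fun τ hτ => norm_ne_zero_iff.2 (hne τ hτ)
    have hγo := hγs.contDiffOn (s := Icc 0 1)
    fun_prop
  have hu : ContDiffOn ℝ 1 (fun τ => g (x₀ + t • ‖γ τ‖⁻¹ • γ τ)) (Icc 0 1) :=
    hg.comp_contDiffOn hP
  have hFTC := enorm_sub_le_lintegral_deriv_of_contDiffOn_Icc hu zero_le_one
  have e0 : γ 0 = a := by simp [hγ]
  have e1 : γ 1 = b := by simp [hγ]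
  simp only [e0, e1] at hFTC
  refine hFTC.trans ?_
  rw [← restrict_Ioo_eq_restrict_Icc]
  refine setLIntegral_mono' measurableSet_Ioo fun τ hτ => ?_
  have hτ' : τ ∈ Icc (0 : ℝ) 1 := ⟨hτ.1.le, hτ.2.le⟩
  have hγd : HasDerivAt γ (b - a) τ := by
    have h1 : HasDerivAt (fun τ : ℝ => (1 - τ) • a) (-a) τ := by
      simpa using ((hasDerivAt_id τ).const_sub 1).smul_const a
    have h2 : HasDerivAt (fun τ : ℝ => τ • b) b τ := by
      simpa using (hasDerivAt_id τ).smul_const b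
    have := h1.add h2
    rwa [neg_add_eq_sub] at this
  have hpos : 0 < ‖γ τ‖ := norm_pos_iff.2 (hne τ hτ')
  have hφd : HasDerivAt (fun τ => ‖γ τ‖) (deriv (fun τ => ‖γ τ‖) τ) τ :=
    ((hφ τ hτ').contDiffAt (Icc_mem_nhds hτ.1 hτ.2)).differentiableAt one_ne_zero |>.hasDerivAt
  set φ' := deriv (fun τ => ‖γ τ‖) τ with hφ'
  have hφ'le : |φ'| ≤ ‖b - a‖ := by
    rw [← Real.norm_eq_abs]
    refine norm_deriv_le_of_lip' (norm_nonneg _) (Filter.Eventually.of_forall fun σ => ?_)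
    refine (abs_norm_sub_norm_le _ _).trans (le_of_eq ?_)
    have : γ σ - γ τ = (σ - τ) • (b - a) := by simp only [hγ]; module
    rw [this, norm_smul, mul_comm]
  have hPd : HasDerivAt (fun τ => x₀ + t • ‖γ τ‖⁻¹ • γ τ)
      (t • (‖γ τ‖⁻¹ • (b - a) + (-φ' / ‖γ τ‖ ^ 2) • γ τ)) τ :=
    (((hφd.inv hpos.ne').smul hγd).const_smul t).const_add x₀
  have hud : HasDerivAt (fun τ => g (x₀ + t • ‖γ τ‖⁻¹ • γ τ))
      (fderiv ℝ g (x₀ + t • ‖γ τ‖⁻¹ • γ τ)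
        (t • (‖γ τ‖⁻¹ • (b - a) + (-φ' / ‖γ τ‖ ^ 2) • γ τ))) τ := ((hg.differentiable one_ne_zero).differentiableAt.hasFDerivAt).comp_hasDerivAt τ hPd
  rw [hud.deriv, mul_comm, ← ofReal_norm (fderiv ℝ g _), ← ofReal_norm,
    ← ENNReal.ofReal_mul (norm_nonneg _)]
  refine ENNReal.ofReal_le_ofReal ((ContinuousLinearMap.le_opNorm _ _).trans ?_)
  refine mul_le_mul_of_nonneg_left ?_ (norm_nonneg _)
  rw [norm_smul, Real.norm_of_nonneg ht.le, mul_assoc]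
  gcongr
  have hcγ : c ≤ ‖γ τ‖ := hab τ hτ'
  calc ‖‖γ τ‖⁻¹ • (b - a) + (-φ' / ‖γ τ‖ ^ 2) • γ τ‖
      ≤ ‖γ τ‖⁻¹ * ‖b - a‖ + |φ'| / ‖γ τ‖ ^ 2 * ‖γ τ‖ := by
        refine (norm_add_le _ _).trans ?_
        rw [norm_smul, norm_smul, norm_inv, norm_norm, norm_div, norm_neg, norm_pow, norm_norm,
          Real.norm_eq_abs]
    _ ≤ ‖γ τ‖⁻¹ * ‖b - a‖ + ‖b - a‖ / ‖γ τ‖ ^ 2 * ‖γ τ‖ := by gcongr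
    _ = 2 / ‖γ τ‖ * ‖b - a‖ := by field_simp; ring
    _ ≤ 2 / c * ‖b - a‖ := by gcongr

/-- The inner product conditions keep the segments from `y` and from `z` to points near `w` away from
the origin, even when `y` and `z` are antipodal. -/
theorem exists_unit_vector_orthogonal {n : ℕ} (hn : 2 ≤ n) (y z : EuclideanSpace ℝ (Fin n)) :
    ∃ w : EuclideanSpace ℝ (Fin n), ‖w‖ = 1 ∧ inner ℝ y w = 0 ∧ 0 ≤ inner ℝ z w := by
  have hne : (ℝ ∙ y)ᗮ ≠ ⊥ := by
    intro h
    have h1 := Submodule.finrank_add_finrank_orthogonal (ℝ ∙ y)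
    rw [h, finrank_bot, finrank_euclideanSpace_fin] at h1
    have := finrank_span_le_card (R := ℝ) ({y} : Set (EuclideanSpace ℝ (Fin n)))
    simp only [toFinset_singleton, Finset.card_singleton] at this
    omega
  obtain ⟨v, hv, hv0⟩ := Submodule.exists_mem_ne_zero_of_ne_bot hne
  rw [Submodule.mem_orthogonal_singleton_iff_inner_right] at hv
  have hvn : ‖v‖ ≠ 0 := norm_ne_zero_iff.2 hv0
  rcases le_total 0 (inner ℝ z v) with h | h
  · refine ⟨‖v‖⁻¹ • v, ?_, ?_, ?_⟩
    · rw [norm_smul, norm_inv, norm_norm, inv_mul_cancel₀ hvn]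
    · rw [inner_smul_right, hv, mul_zero]
    · rw [inner_smul_right]; positivity
  · refine ⟨-(‖v‖⁻¹ • v), ?_, ?_, ?_⟩
    · rw [norm_neg, norm_smul, norm_inv, norm_norm, inv_mul_cancel₀ hvn]
    · rw [inner_neg_right, inner_smul_right, hv, mul_zero, neg_zero]
    · rw [inner_neg_right, inner_smul_right, ← mul_neg]
      exact mul_nonneg (by positivity) (by linarith)

/-- The segments from `s y` to points near `w₀` stay in a fixed shell around the origin, on which the
radial projection is Lipschitz. -/
theorem norm_segment_bounds {n : ℕ} {y w₀ w : EuclideanSpace ℝ (Fin n)} (hy : ‖y‖ = 1)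
    (hw₀ : ‖w₀‖ = 1) (hyw : 0 ≤ inner ℝ y w₀) (hw : w ∈ Metric.ball w₀ (1 / 4)) {s τ : ℝ}
    (hs : s ∈ Icc (1 : ℝ) 2) (hτ : τ ∈ Icc (0 : ℝ) 1) :
    1 / 3 ≤ ‖((1 - τ) * s) • y + τ • w‖ ∧ ‖((1 - τ) * s) • y + τ • w‖ ≤ 4 := by
  have hd : ‖w - w₀‖ < 1 / 4 := by rwa [← dist_eq_norm]
  obtain ⟨hs1, hs2⟩ := hs
  obtain ⟨ht0, ht1⟩ := hτ
  have hτs : 0 ≤ (1 - τ) * s := mul_nonneg (by linarith) (by linarith)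
  have e : ((1 - τ) * s) • y + τ • w = (((1 - τ) * s) • y + τ • w₀) + τ • (w - w₀) := by module
  have hsm : ‖τ • (w - w₀)‖ ≤ 1 / 4 := by
    rw [norm_smul, Real.norm_of_nonneg ht0]
    nlinarith [norm_nonneg (w - w₀)]
  constructor
  · have hsq : ‖((1 - τ) * s) • y + τ • w₀‖ ^ 2 =
        ((1 - τ) * s) ^ 2 + 2 * ((1 - τ) * s * τ * inner ℝ y w₀) + τ ^ 2 := by
      rw [norm_add_sq_real, norm_smul, norm_smul, hy, hw₀, inner_smul_left, inner_smul_right,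
        Real.norm_of_nonneg ht0, Real.norm_of_nonneg hτs]
      simp only [conj_trivial]
      ring
    have h1 : (7 / 12 : ℝ) ≤ ‖((1 - τ) * s) • y + τ • w₀‖ := by
      refine le_of_sq_le_sq ?_ (norm_nonneg _)
      rw [hsq]
      have h2 : 0 ≤ (1 - τ) * s * τ * inner ℝ y w₀ := by positivity
      have h3 : 1 - τ ≤ (1 - τ) * s := le_mul_of_one_le_right (by linarith) hs1
      nlinarith [sq_nonneg (2 * τ - 1), pow_le_pow_left₀ (by linarith) h3 2]
    have := norm_sub_le_norm_add (((1 - τ) * s) • y + τ • w₀) (τ • (w - w₀))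
    rw [e]
    linarith
  · rw [e]
    refine (norm_add_le _ _).trans ?_
    have := norm_add_le (((1 - τ) * s) • y) (τ • w₀)
    rw [norm_smul, norm_smul, hy, hw₀, Real.norm_of_nonneg ht0, Real.norm_of_nonneg hτs] at this
    nlinarith

/-- A Sobolev embedding on spheres: for `p > n - 1` the oscillation of a smooth map over an
`(n - 1)`-dimensional sphere is controlled by the `L^p` norm of its derivative on the sphere. The
integral over the sphere is written as an integral over a shell of a function that is constant
on rays. -/
theorem exists_enorm_sub_rpow_le_sphere {n : ℕ} (hn : 2 ≤ n) {p : ℝ} (hp : (n : ℝ) - 1 < p) :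
    ∃ K : ℝ≥0∞, K ≠ ⊤ ∧ ∀ g : EuclideanSpace ℝ (Fin n) → EuclideanSpace ℝ (Fin n),
      ContDiff ℝ 1 g → ∀ x₀ y z : EuclideanSpace ℝ (Fin n), ∀ t : ℝ, 0 < t → ‖y‖ = 1 → ‖z‖ = 1 →
      ‖g (x₀ + t • y) - g (x₀ + t • z)‖ₑ ^ p ≤ K * ENNReal.ofReal t ^ p *
        ∫⁻ x in {x | 1 / 3 ≤ ‖x‖ ∧ ‖x‖ ≤ 4}, ‖fderiv ℝ g (x₀ + t • ‖x‖⁻¹ • x)‖ₑ ^ p := by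
  have hn' : (2 : ℝ) ≤ n := by exact_mod_cast hn
  have hp1 : 1 ≤ p := by linarith
  have hp0 : 0 < p := by linarith
  obtain ⟨K, hK, hKb⟩ := exists_lintegral_segments_le hp1 hp
  set V : ℝ≥0∞ := volume (Metric.ball (0 : EuclideanSpace ℝ (Fin n)) (1 / 4)) with hV
  have hVt : V ≠ ⊤ := measure_ball_lt_top.ne
  have hV0 : V ≠ 0 := (Metric.measure_ball_pos _ _ (by norm_num)).ne'
  refine ⟨(2 * K / V) ^ p * ENNReal.ofReal 24 ^ p, ?_, ?_⟩
  · refine ENNReal.mul_ne_top (ENNReal.rpow_ne_top_of_nonneg hp0.le ?_)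
      (ENNReal.rpow_ne_top_of_nonneg hp0.le ENNReal.ofReal_ne_top)
    exact ENNReal.div_ne_top (ENNReal.mul_ne_top (by simp) hK) hV0
  intro g hg x₀ y z t ht hy hz
  set A : Set (EuclideanSpace ℝ (Fin n)) := {x | 1 / 3 ≤ ‖x‖ ∧ ‖x‖ ≤ 4} with hA
  have hAm : MeasurableSet A := by
    refine MeasurableSet.inter ?_ ?_
    · exact measurableSet_le measurable_const measurable_norm
    · exact measurableSet_le measurable_norm measurable_const
  set G : EuclideanSpace ℝ (Fin n) → ℝ≥0∞ := A.indicator fun x =>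
    ENNReal.ofReal (24 * t) * ‖fderiv ℝ g (x₀ + t • ‖x‖⁻¹ • x)‖ₑ with hG
  have hGm : Measurable G := by
    refine Measurable.indicator ?_ hAm
    have : Continuous (fderiv ℝ g) := hg.continuous_fderiv one_ne_zero
    have h2 : Measurable fun x : EuclideanSpace ℝ (Fin n) => x₀ + t • ‖x‖⁻¹ • x := by fun_prop
    exact ((this.measurable.comp h2).enorm).const_mul _
  have hGp : ∫⁻ x, G x ^ p = ENNReal.ofReal (24 * t) ^ p *
      ∫⁻ x in A, ‖fderiv ℝ g (x₀ + t • ‖x‖⁻¹ • x)‖ₑ ^ p := by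
    rw [← lintegral_const_mul' _ _ (ENNReal.rpow_ne_top_of_nonneg hp0.le ENNReal.ofReal_ne_top),
      ← lintegral_indicator hAm]
    congr 1
    funext x
    by_cases hx : x ∈ A
    · rw [hG, indicator_of_mem hx, indicator_of_mem hx, ENNReal.mul_rpow_of_nonneg _ _ hp0.le]
    · rw [hG, indicator_of_notMem hx, indicator_of_notMem hx, ENNReal.zero_rpow_of_pos hp0]
  obtain ⟨w₀, hw₀, hyw, hzw⟩ := exists_unit_vector_orthogonal hn y z
  have hseg : ∀ y : EuclideanSpace ℝ (Fin n), ‖y‖ = 1 → 0 ≤ inner ℝ y w₀ →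
      ∀ s ∈ Icc (1 : ℝ) 2, ∀ w ∈ Metric.ball w₀ (1 / 4),
      ‖g (x₀ + t • ‖w‖⁻¹ • w) - g (x₀ + t • y)‖ₑ ≤
        ∫⁻ τ in Icc (0 : ℝ) 1, G (((1 - τ) * s) • y + τ • w) := by
    intro y hy hyw s hs w hw
    have hb := fun τ hτ => norm_segment_bounds hy hw₀ hyw hw hs (τ := τ) hτ
    have h1 := enorm_sub_le_lintegral_radial hg x₀ ht (a := s • y) (b := w) (c := 1 / 3)
      (by norm_num) (fun τ hτ => by rw [smul_smul]; exact (hb τ hτ).1)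
    have hs0 : 0 < s := by linarith [hs.1]
    have e : ‖s • y‖⁻¹ • s • y = y := by
      rw [norm_smul, hy, mul_one, Real.norm_of_nonneg hs0.le, smul_smul, inv_mul_cancel₀ hs0.ne',
        one_smul]
    rw [e] at h1
    refine h1.trans (setLIntegral_mono' measurableSet_Icc fun τ hτ => ?_)
    rw [smul_smul (1 - τ) s y, hG, indicator_of_mem (show _ ∈ A from hb τ hτ)]
    have hle : ‖w - s • y‖ ≤ 4 := by
      have h2 : ‖w - w₀‖ < 1 / 4 := by rw [← dist_eq_norm]; exact hw
      have h3 : w - s • y = (w - w₀) + (w₀ - s • y) := by abel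
      have h4 := norm_add_le (w - w₀) (w₀ - s • y)
      have h5 := norm_sub_le w₀ (s • y)
      rw [norm_smul, hy, mul_one, Real.norm_of_nonneg hs0.le] at h5
      rw [h3]
      linarith [hs.2]
    gcongr ENNReal.ofReal ?_ * _
    nlinarith
  have hGm3 : ∀ y : EuclideanSpace ℝ (Fin n), Measurable
      fun q : (ℝ × EuclideanSpace ℝ (Fin n)) × ℝ => G (((1 - q.2) * q.1.1) • y + q.2 • q.1.2) :=
    fun y => hGm.comp (by fun_prop)
  -- Both `y` and `z` are compared with the same points `w`, and the inequality is averaged.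
  have hmain : V * ‖g (x₀ + t • y) - g (x₀ + t • z)‖ₑ ≤ 2 * K * (∫⁻ x, G x ^ p) ^ (1 / p) := by
    have hVe : V * ‖g (x₀ + t • y) - g (x₀ + t • z)‖ₑ = ∫⁻ s in Icc (1 : ℝ) 2,
        ∫⁻ w in Metric.ball w₀ (1 / 4), ‖g (x₀ + t • y) - g (x₀ + t • z)‖ₑ := by
      rw [setLIntegral_const, setLIntegral_const, Real.volume_Icc, hV, Measure.addHaar_ball_center _ w₀]
      norm_num [mul_comm]
    rw [hVe]
    calc ∫⁻ s in Icc (1 : ℝ) 2, ∫⁻ w in Metric.ball w₀ (1 / 4),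
          ‖g (x₀ + t • y) - g (x₀ + t • z)‖ₑ
        ≤ ∫⁻ s in Icc (1 : ℝ) 2, ∫⁻ w in Metric.ball w₀ (1 / 4),
          ((∫⁻ τ in Icc (0 : ℝ) 1, G (((1 - τ) * s) • y + τ • w)) +
            ∫⁻ τ in Icc (0 : ℝ) 1, G (((1 - τ) * s) • z + τ • w)) := by
          refine setLIntegral_mono' measurableSet_Icc fun s hs => ?_
          refine setLIntegral_mono' measurableSet_ball fun w hw => ?_
          refine le_trans ?_ (add_le_add (hseg y hy hyw.ge s hs w hw) (hseg z hz hzw s hs w hw))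
          rw [← edist_eq_enorm_sub, ← edist_eq_enorm_sub, ← edist_eq_enorm_sub]
          exact edist_triangle_left _ _ _
      _ = (∫⁻ s in Icc (1 : ℝ) 2, ∫⁻ w in Metric.ball w₀ (1 / 4),
            ∫⁻ τ in Icc (0 : ℝ) 1, G (((1 - τ) * s) • y + τ • w)) +
          ∫⁻ s in Icc (1 : ℝ) 2, ∫⁻ w in Metric.ball w₀ (1 / 4),
            ∫⁻ τ in Icc (0 : ℝ) 1, G (((1 - τ) * s) • z + τ • w) := by
          have hm2 : ∀ y : EuclideanSpace ℝ (Fin n), Measurable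
              fun q : ℝ × EuclideanSpace ℝ (Fin n) =>
                ∫⁻ τ in Icc (0 : ℝ) 1, G (((1 - τ) * q.1) • y + τ • q.2) :=
            fun y => (hGm3 y).lintegral_prod_right'
          rw [← lintegral_add_left (hm2 y).lintegral_prod_right']
          congr 1
          funext s
          exact lintegral_add_left ((hm2 y).comp (measurable_prodMk_left (x := s))) _
      _ ≤ _ := by
          refine (add_le_add (hKb G hGm y w₀ hy) (hKb G hGm z w₀ hz)).trans (le_of_eq ?_)
          ring
  have h2 : ‖g (x₀ + t • y) - g (x₀ + t • z)‖ₑ ≤ 2 * K / V * (∫⁻ x, G x ^ p) ^ (1 / p) := by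
    rw [ENNReal.mul_div_right_comm.symm, ENNReal.le_div_iff_mul_le (Or.inl hV0) (Or.inl hVt),
      mul_comm]
    exact hmain
  calc ‖g (x₀ + t • y) - g (x₀ + t • z)‖ₑ ^ p
      ≤ (2 * K / V * (∫⁻ x, G x ^ p) ^ (1 / p)) ^ p := by gcongr
    _ = _ := by
      rw [ENNReal.mul_rpow_of_nonneg _ _ hp0.le, ← ENNReal.rpow_mul, one_div_mul_cancel hp0.ne',
        ENNReal.rpow_one, hGp, ENNReal.ofReal_mul (by norm_num), ENNReal.mul_rpow_of_nonneg _ _ hp0.le]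
      ring

/-- A substitute for integration in polar coordinates: the function `x ↦ H (t x / ‖x‖)` on the shell
represents the restriction of `H` to the sphere of radius `t`. -/
theorem lintegral_radial_le {n : ℕ} {H : EuclideanSpace ℝ (Fin n) → ℝ≥0∞} (hH : Measurable H)
    {r : ℝ} (hr : 0 < r) :
    ∫⁻ t in Ioo r (2 * r), ∫⁻ x in {x | 1 / 3 ≤ ‖x‖ ∧ ‖x‖ ≤ 4}, H (t • ‖x‖⁻¹ • x) ≤
      ENNReal.ofReal (24 * 4 ^ n * (r * (r ^ n)⁻¹)) * ∫⁻ z in Metric.ball 0 (2 * r), H z := by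
  set A : Set (EuclideanSpace ℝ (Fin n)) := {x | 1 / 3 ≤ ‖x‖ ∧ ‖x‖ ≤ 4} with hA
  have hAm : MeasurableSet A := by
    refine MeasurableSet.inter ?_ ?_
    · exact measurableSet_le measurable_const measurable_norm
    · exact measurableSet_le measurable_norm measurable_const
  -- For fixed `x`, substitute `t = ‖x‖ s`; then for fixed `s`, substitute `z = s x`.
  set F : EuclideanSpace ℝ (Fin n) → ℝ≥0∞ := (Metric.ball 0 (2 * r)).indicator H with hF
  have hFm : Measurable F := hH.indicator measurableSet_ball
  have hsub : ∀ x ∈ A, ∫⁻ t in Ioo r (2 * r), H (t • ‖x‖⁻¹ • x) ≤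
      ENNReal.ofReal 4 * ∫⁻ s in Ioo (r / 4) (6 * r), F (s • x) := by
    intro x hx
    have hx0 : 0 < ‖x‖ := by linarith [hx.1]
    have h1 : ∫⁻ t in Ioo r (2 * r), H (t • ‖x‖⁻¹ • x) =
        ENNReal.ofReal ‖x‖ * ∫⁻ s, (Ioo r (2 * r)).indicator
          (fun t => H (t • ‖x‖⁻¹ • x)) (‖x‖ * s) := by
      have hm : Measurable ((Ioo r (2 * r)).indicator (fun t => H (t • ‖x‖⁻¹ • x))) :=
        Measurable.indicator (by fun_prop) measurableSet_Ioo
      rw [← lintegral_map (f := (Ioo r (2 * r)).indicator (fun t => H (t • ‖x‖⁻¹ • x)))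
        (g := fun s => ‖x‖ * s) hm (by fun_prop), Real.map_volume_mul_left hx0.ne',
        lintegral_smul_measure, smul_eq_mul, ← mul_assoc, ← ENNReal.ofReal_mul hx0.le,
        abs_of_pos (by positivity), mul_inv_cancel₀ hx0.ne', ENNReal.ofReal_one, one_mul,
        lintegral_indicator measurableSet_Ioo]
    rw [h1]
    refine mul_le_mul' (ENNReal.ofReal_le_ofReal hx.2) ?_
    · rw [← lintegral_indicator measurableSet_Ioo]
      refine lintegral_mono fun s => ?_
      by_cases hs : ‖x‖ * s ∈ Ioo r (2 * r)
      · rw [indicator_of_mem hs]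
        have hs0 : 0 < s := by
          by_contra! hc
          nlinarith [hs.1]
        have hs1 : s ∈ Ioo (r / 4) (6 * r) := by
          have h3 := hs.1
          have h4 := hs.2
          constructor
          · nlinarith [hx.2]
          · nlinarith [hx.1]
        have e : (‖x‖ * s) • ‖x‖⁻¹ • x = s • x := by
          rw [smul_smul]; congr 1; field_simp
        rw [indicator_of_mem hs1, hF, indicator_of_mem, e]
        rw [mem_ball_zero_iff, norm_smul, Real.norm_of_nonneg hs0.le, mul_comm]
        exact hs.2
      · rw [indicator_of_notMem hs]; exact zero_le
  have hm2 : Measurable fun q : EuclideanSpace ℝ (Fin n) × ℝ => F (q.2 • q.1) :=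
    hFm.comp (by fun_prop)
  have hm1 : Measurable fun q : ℝ × EuclideanSpace ℝ (Fin n) => H (q.1 • ‖q.2‖⁻¹ • q.2) :=
    hH.comp (by fun_prop)
  calc ∫⁻ t in Ioo r (2 * r), ∫⁻ x in A, H (t • ‖x‖⁻¹ • x)
      = ∫⁻ x in A, ∫⁻ t in Ioo r (2 * r), H (t • ‖x‖⁻¹ • x) :=
        lintegral_lintegral_swap hm1.aemeasurable
    _ ≤ ∫⁻ x in A, ENNReal.ofReal 4 * ∫⁻ s in Ioo (r / 4) (6 * r), F (s • x) :=
        setLIntegral_mono' hAm hsub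
    _ ≤ ENNReal.ofReal 4 * ∫⁻ s in Ioo (r / 4) (6 * r), ∫⁻ x, F (s • x) := by
        rw [lintegral_const_mul' _ _ ENNReal.ofReal_ne_top,
          lintegral_lintegral_swap hm2.aemeasurable]
        gcongr
        exact Measure.restrict_le_self
    _ ≤ ENNReal.ofReal 4 * ∫⁻ s in Ioo (r / 4) (6 * r),
          ENNReal.ofReal ((r / 4) ^ n)⁻¹ * ∫⁻ z, F z := by
        gcongr 1
        refine setLIntegral_mono' measurableSet_Ioo fun s hs => ?_
        have hs0 : 0 < s := by linarith [hs.1]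
        have := lintegral_comp_add_smul hFm 0 hs0
        simp only [zero_add] at this
        rw [this]
        gcongr
        exact hs.1.le
    _ ≤ ENNReal.ofReal 4 * (ENNReal.ofReal ((r / 4) ^ n)⁻¹ * (∫⁻ z, F z) *
          ENNReal.ofReal (6 * r)) := by
        rw [setLIntegral_const, Real.volume_Ioo]
        gcongr
        linarith
    _ = _ := by
        rw [hF, lintegral_indicator measurableSet_ball]
        have : 24 * 4 ^ n * (r * (r ^ n)⁻¹) = 4 * ((r / 4) ^ n)⁻¹ * (6 * r) := by
          rw [div_pow]; field_simp; norm_num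
        rw [this, ENNReal.ofReal_mul (p := 4 * ((r / 4) ^ n)⁻¹) (by positivity),
          ENNReal.ofReal_mul (p := 4) (by norm_num)]
        ring

/-- If a smooth map oscillates by at least `m` on every sphere with centre `x₀` and radius between
`r` and `2 r`, then its `p`-energy on the ball of radius `2 r` is bounded below. -/
theorem exists_rpow_le_lintegral_of_forall_sphere {n : ℕ} (hn : 2 ≤ n) {p : ℝ}
    (hp : (n : ℝ) - 1 < p) :
    ∃ K : ℝ≥0∞, K ≠ ⊤ ∧ ∀ g : EuclideanSpace ℝ (Fin n) → EuclideanSpace ℝ (Fin n),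
      ContDiff ℝ 1 g → ∀ (x₀ : EuclideanSpace ℝ (Fin n)) (r : ℝ) (m : ℝ≥0∞), 0 < r →
      (∀ t ∈ Ioo r (2 * r), ∃ y z : EuclideanSpace ℝ (Fin n), ‖y‖ = 1 ∧ ‖z‖ = 1 ∧
        m ≤ ‖g (x₀ + t • y) - g (x₀ + t • z)‖ₑ) →
      m ^ p ≤ K * ENNReal.ofReal (r ^ p * (r ^ n)⁻¹) *
        ∫⁻ z in Metric.ball x₀ (2 * r), ‖fderiv ℝ g z‖ₑ ^ p := by
  have hn' : (2 : ℝ) ≤ n := by exact_mod_cast hn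
  have hp0 : 0 < p := by linarith
  obtain ⟨K, hK, hKb⟩ := exists_enorm_sub_rpow_le_sphere hn hp
  refine ⟨K * ENNReal.ofReal (2 ^ p * (24 * 4 ^ n)), ENNReal.mul_ne_top hK ENNReal.ofReal_ne_top,
    fun g hg x₀ r m hr hm => ?_⟩
  set H : EuclideanSpace ℝ (Fin n) → ℝ≥0∞ := fun x => ‖fderiv ℝ g (x₀ + x)‖ₑ ^ p with hH
  have hHm : Measurable H := by
    have : Continuous (fderiv ℝ g) := hg.continuous_fderiv one_ne_zero
    have h2 : Continuous fun x => fderiv ℝ g (x₀ + x) := by fun_prop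
    exact h2.measurable.enorm.pow_const p
  have hr0 : ENNReal.ofReal r ≠ 0 := by simpa using hr
  have h1 : ENNReal.ofReal r * m ^ p ≤ K * ENNReal.ofReal ((2 * r) ^ p) *
      (ENNReal.ofReal (24 * 4 ^ n * (r * (r ^ n)⁻¹)) * ∫⁻ z in Metric.ball 0 (2 * r), H z) := by
    calc ENNReal.ofReal r * m ^ p = ∫⁻ t in Ioo r (2 * r), m ^ p := by
          rw [setLIntegral_const, Real.volume_Ioo, mul_comm]; congr 2; ring
      _ ≤ ∫⁻ t in Ioo r (2 * r), K * ENNReal.ofReal ((2 * r) ^ p) *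
          ∫⁻ x in {x | 1 / 3 ≤ ‖x‖ ∧ ‖x‖ ≤ 4}, H (t • ‖x‖⁻¹ • x) := by
          refine setLIntegral_mono' measurableSet_Ioo fun t ht => ?_
          obtain ⟨y, z, hy, hz, hyz⟩ := hm t ht
          have ht0 : 0 < t := hr.trans ht.1
          refine (ENNReal.rpow_le_rpow hyz hp0.le).trans ((hKb g hg x₀ y z t ht0 hy hz).trans ?_)
          rw [← ENNReal.ofReal_rpow_of_pos (by positivity)]
          gcongr
          exact ht.2.le
      _ ≤ _ := by
          rw [lintegral_const_mul' _ _ (ENNReal.mul_ne_top hK ENNReal.ofReal_ne_top)]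
          gcongr
          exact lintegral_radial_le hHm hr
  have h2 : ∫⁻ z in Metric.ball 0 (2 * r), H z =
      ∫⁻ z in Metric.ball x₀ (2 * r), ‖fderiv ℝ g z‖ₑ ^ p := by
    rw [← lintegral_indicator measurableSet_ball, ← lintegral_indicator measurableSet_ball,
      ← lintegral_add_left_eq_self (μ := volume)
        ((Metric.ball x₀ (2 * r)).indicator fun z => ‖fderiv ℝ g z‖ₑ ^ p) x₀]
    congr 1
    funext x
    simp [indicator, hH]
  rw [h2] at h1
  rw [← ENNReal.mul_le_mul_iff_right hr0 ENNReal.ofReal_ne_top]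
  refine h1.trans (le_of_eq ?_)
  have e : (2 * r) ^ p * (24 * 4 ^ n * (r * (r ^ n)⁻¹)) =
      r * ((2 ^ p * (24 * 4 ^ n)) * (r ^ p * (r ^ n)⁻¹)) := by
    rw [Real.mul_rpow (by norm_num) hr.le]; ring
  calc K * ENNReal.ofReal ((2 * r) ^ p) * (ENNReal.ofReal (24 * 4 ^ n * (r * (r ^ n)⁻¹)) *
        ∫⁻ z in Metric.ball x₀ (2 * r), ‖fderiv ℝ g z‖ₑ ^ p)
      = K * ENNReal.ofReal ((2 * r) ^ p * (24 * 4 ^ n * (r * (r ^ n)⁻¹))) *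
        ∫⁻ z in Metric.ball x₀ (2 * r), ‖fderiv ℝ g z‖ₑ ^ p := by
        rw [ENNReal.ofReal_mul (p := (2 * r) ^ p) (by positivity)]; ring
    _ = _ := by
        rw [e, ENNReal.ofReal_mul hr.le, ENNReal.ofReal_mul (by positivity)]; ring

/-! ### Mollification -/

/-- The derivative of a mollified Sobolev map is the mollified weak derivative, at points whose
distance to the complement of the domain exceeds the mollification radius. -/
theorem IsW11WithDeriv.hasFDerivAt_convolution {n : ℕ}
    {f : EuclideanSpace ℝ (Fin n) → EuclideanSpace ℝ (Fin n)}
    {Df : EuclideanSpace ℝ (Fin n) → EuclideanSpace ℝ (Fin n) →L[ℝ] EuclideanSpace ℝ (Fin n)}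
    {Ω : Set (EuclideanSpace ℝ (Fin n))} (hf : IsW11WithDeriv f Df Ω) (hΩ : MeasurableSet Ω)
    (φ : ContDiffBump (0 : EuclideanSpace ℝ (Fin n))) {x : EuclideanSpace ℝ (Fin n)}
    (hx : Metric.closedBall x φ.rOut ⊆ Ω) :
    HasFDerivAt (convolution (φ.normed volume) (Ω.indicator f)
      (ContinuousLinearMap.lsmul ℝ ℝ) volume) (∫ y in Ω, φ.normed volume (x - y) • Df y) x := by
  have hint : Integrable (Ω.indicator f) := hf.integrable.integrable_indicator hΩ
  have hφs : ContDiff ℝ 1 (φ.normed volume) := φ.contDiff_normed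
  have hφc : HasCompactSupport (φ.normed volume) := φ.hasCompactSupport_normed
  have h1 := hφc.hasFDerivAt_convolution_left (ContinuousLinearMap.lsmul ℝ ℝ) hφs
    hint.locallyIntegrable x
  refine h1.congr_fderiv (Eq.symm ?_)
  have hex : ConvolutionExistsAt (fderiv ℝ (φ.normed volume)) (Ω.indicator f) x
      (ContinuousLinearMap.precompL (EuclideanSpace ℝ (Fin n)) (ContinuousLinearMap.lsmul ℝ ℝ))
      volume :=
    (hφc.fderiv ℝ).convolutionExists_left _ (hφs.continuous_fderiv one_ne_zero)
      hint.locallyIntegrable x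
  have hbound : ∃ C, ∀ y, ‖φ.normed volume y‖ ≤ C :=
    hφs.continuous.bounded_above_of_compact_support hφc
  obtain ⟨C, hC⟩ := hbound
  have hint2 : Integrable (fun y => φ.normed volume (x - y) • Df y) (volume.restrict Ω) := by
    refine Integrable.bdd_smul (𝕜 := ℝ) (C := C) hf.integrable_deriv ?_ ?_
    · exact (hφs.continuous.comp (by fun_prop)).aestronglyMeasurable
    · exact Filter.Eventually.of_forall fun y => hC _
  ext1 v
  rw [ContinuousLinearMap.integral_apply hint2, convolution, ContinuousLinearMap.integral_apply hex]
  simp only [smul_apply, ContinuousLinearMap.precompL_apply,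
    ContinuousLinearMap.lsmul_apply]
  rw [← integral_sub_left_eq_self (μ := volume) _ x]
  simp only [sub_sub_cancel]
  have e1 : ∀ y, fderiv ℝ (φ.normed volume) (x - y) v • Ω.indicator f y =
      Ω.indicator (fun y => fderiv ℝ (φ.normed volume) (x - y) v • f y) y := by
    intro y
    by_cases hy : y ∈ Ω <;> simp [hy]
  simp_rw [e1]
  rw [integral_indicator hΩ]
  have hψ := hf.integral_by_parts (fun y => φ.normed volume (x - y))
    (φ.contDiff_normed.comp (contDiff_const.sub contDiff_id))
    (hφc.comp_homeomorph (Homeomorph.subLeft x)) ?_ v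
  · rw [← neg_inj, ← hψ, ← integral_neg]
    congr 1
    funext y
    have hd := (hφs.differentiable one_ne_zero (x - y)).hasFDerivAt.comp y
      ((hasFDerivAt_id y).const_sub x)
    have : fderiv ℝ (fun y => φ.normed volume (x - y)) y v =
        -fderiv ℝ (φ.normed volume) (x - y) v := by
      rw [show (fun y => φ.normed volume (x - y)) = φ.normed volume ∘ HSub.hSub x from rfl,
        hd.fderiv]
      simp
    rw [this, neg_smul]
  · refine Subset.trans ?_ hx
    refine closure_minimal (fun y hy => ?_) Metric.isClosed_closedBall
    have hy' : x - y ∈ Function.support (φ.normed volume) := hy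
    rw [φ.support_normed_eq, mem_ball_zero_iff] at hy'
    rw [Metric.mem_closedBall, dist_comm, dist_eq_norm]
    exact hy'.le

/-- Mollification does not increase the `p`-energy, by the inequality of Jensen for the
probability density `y ↦ φ (x - y)`. -/
theorem IsW11WithDeriv.lintegral_fderiv_convolution_rpow_le {n : ℕ}
    {f : EuclideanSpace ℝ (Fin n) → EuclideanSpace ℝ (Fin n)}
    {Df : EuclideanSpace ℝ (Fin n) → EuclideanSpace ℝ (Fin n) →L[ℝ] EuclideanSpace ℝ (Fin n)}
    {Ω : Set (EuclideanSpace ℝ (Fin n))} (hf : IsW11WithDeriv f Df Ω) (hΩ : MeasurableSet Ω)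
    (φ : ContDiffBump (0 : EuclideanSpace ℝ (Fin n))) {x₀ : EuclideanSpace ℝ (Fin n)} {R : ℝ}
    (hx : Metric.closedBall x₀ (R + φ.rOut) ⊆ Ω) {p : ℝ} (hp : 1 ≤ p) :
    ∫⁻ x in Metric.ball x₀ R, ‖fderiv ℝ (convolution (φ.normed volume) (Ω.indicator f)
      (ContinuousLinearMap.lsmul ℝ ℝ) volume) x‖ₑ ^ p ≤
      ∫⁻ x in Metric.ball x₀ (R + φ.rOut), ‖Df x‖ₑ ^ p := by
  have hp0 : 0 < p := by linarith
  set ψ : EuclideanSpace ℝ (Fin n) → ℝ≥0∞ := fun z => ENNReal.ofReal (φ.normed volume z) with hψ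
  have hψm : Measurable ψ :=
    ENNReal.measurable_ofReal.comp φ.continuous_normed.measurable
  have hψ1 : ∫⁻ z, ψ z = 1 := by
    rw [hψ, ← ofReal_integral_eq_lintegral_ofReal φ.integrable_normed
      (Filter.Eventually.of_forall fun z => φ.nonneg_normed z), φ.integral_normed]
    simp
  have hball : Metric.ball x₀ (R + φ.rOut) ⊆ Ω := Metric.ball_subset_closedBall.trans hx
  have hDm : AEMeasurable (fun y => ‖Df y‖ₑ) (volume.restrict Ω) :=
    hf.integrable_deriv.aestronglyMeasurable.enorm
  have hDm' : AEMeasurable (fun y => ‖Df y‖ₑ ^ p)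
      (volume.restrict (Metric.ball x₀ (R + φ.rOut))) :=
    (hDm.mono_measure (Measure.restrict_mono_set _ hball)).pow_const p
  have hpt : ∀ x ∈ Metric.ball x₀ R, ‖fderiv ℝ (convolution (φ.normed volume) (Ω.indicator f)
      (ContinuousLinearMap.lsmul ℝ ℝ) volume) x‖ₑ ^ p ≤
      ∫⁻ y in Metric.ball x₀ (R + φ.rOut), ψ (x - y) * ‖Df y‖ₑ ^ p := by
    intro x hxR
    have hxΩ : Metric.closedBall x φ.rOut ⊆ Ω := by
      refine Subset.trans (Metric.closedBall_subset_closedBall' ?_) hx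
      have := Metric.mem_ball.1 hxR
      linarith
    rw [(hf.hasFDerivAt_convolution hΩ φ hxΩ).fderiv]
    have hm1 : Measurable fun y => ψ (x - y) := hψm.comp (by fun_prop)
    have hae : AEMeasurable (fun y => ‖Df y‖ₑ)
        ((volume.restrict Ω).withDensity fun y => ψ (x - y)) :=
      hDm.mono_ac (withDensity_absolutelyContinuous _ _)
    have hle1 : ((volume.restrict Ω).withDensity fun y => ψ (x - y)) univ ≤ 1 := by
      rw [withDensity_apply _ MeasurableSet.univ, Measure.restrict_univ]
      refine (setLIntegral_le_lintegral _ _).trans ?_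
      rw [lintegral_sub_left_eq_self ψ x, hψ1]
    calc ‖∫ y in Ω, φ.normed volume (x - y) • Df y‖ₑ ^ p
        ≤ (∫⁻ y, ‖Df y‖ₑ ∂((volume.restrict Ω).withDensity fun y => ψ (x - y))) ^ p := by
          gcongr
          refine (enorm_integral_le_lintegral_enorm _).trans (le_of_eq ?_)
          rw [lintegral_withDensity_eq_lintegral_mul₀ hm1.aemeasurable hDm]
          congr 1
          funext y
          simp only [Pi.mul_apply, hψ]
          rw [enorm_smul, Real.enorm_of_nonneg (φ.nonneg_normed _)]
      _ ≤ ((∫⁻ y, ‖Df y‖ₑ ^ p ∂((volume.restrict Ω).withDensity fun y => ψ (x - y))) ^ (1 / p) *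
            1) ^ p := by
          gcongr
          refine (lintegral_rpow_le_measure_univ_mul _ hp hae).trans ?_
          gcongr
          exact ENNReal.rpow_le_one hle1 (by rw [sub_nonneg, div_le_one hp0]; exact hp)
      _ = ∫⁻ y in Ω, ψ (x - y) * ‖Df y‖ₑ ^ p := by
          rw [mul_one, ← ENNReal.rpow_mul, one_div_mul_cancel hp0.ne', ENNReal.rpow_one,
            lintegral_withDensity_eq_lintegral_mul₀ hm1.aemeasurable (hDm.pow_const p)]
          rfl
      _ ≤ ∫⁻ y in Metric.ball x₀ (R + φ.rOut), ψ (x - y) * ‖Df y‖ₑ ^ p := by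
          rw [← lintegral_indicator hΩ, ← lintegral_indicator measurableSet_ball]
          refine lintegral_mono fun y => ?_
          by_cases hy : y ∈ Metric.ball x₀ (R + φ.rOut)
          · rw [indicator_of_mem hy, indicator_of_mem (hball hy)]
          · have : ψ (x - y) = 0 := by
              have h0 : x - y ∉ Function.support (φ.normed volume) := by
                rw [φ.support_normed_eq, mem_ball_zero_iff, ← dist_eq_norm]
                intro hd
                refine hy (Metric.mem_ball.2 ?_)
                have := dist_triangle_left y x₀ x
                have := Metric.mem_ball.1 hxR
                linarith
              rw [Function.notMem_support] at h0
              simp [hψ, h0]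
            rw [indicator_of_notMem hy]
            by_cases hyΩ : y ∈ Ω
            · rw [indicator_of_mem hyΩ, this, zero_mul]
            · rw [indicator_of_notMem hyΩ]
  calc ∫⁻ x in Metric.ball x₀ R, ‖fderiv ℝ (convolution (φ.normed volume) (Ω.indicator f)
      (ContinuousLinearMap.lsmul ℝ ℝ) volume) x‖ₑ ^ p
      ≤ ∫⁻ x in Metric.ball x₀ R, ∫⁻ y in Metric.ball x₀ (R + φ.rOut),
          ψ (x - y) * ‖Df y‖ₑ ^ p := setLIntegral_mono' measurableSet_ball hpt
    _ ≤ ∫⁻ x, ∫⁻ y in Metric.ball x₀ (R + φ.rOut), ψ (x - y) * ‖Df y‖ₑ ^ p :=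
        setLIntegral_le_lintegral _ _
    _ = ∫⁻ y in Metric.ball x₀ (R + φ.rOut), ∫⁻ x, ψ (x - y) * ‖Df y‖ₑ ^ p := by
        refine lintegral_lintegral_swap ?_
        refine AEMeasurable.mul ?_ ?_
        · exact (hψm.comp (by fun_prop)).aemeasurable
        · exact hDm'.comp_snd
    _ = _ := by
        refine lintegral_congr fun y => ?_
        have hm : Measurable fun x => ψ (x - y) := hψm.comp (by fun_prop)
        rw [lintegral_mul_const _ hm, lintegral_sub_right_eq_self ψ y, hψ1,
          one_mul]

/-- Local approximation of a continuous Sobolev map by smooth maps, uniformly and without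
increase of energy beyond a slightly larger ball. -/
theorem IsW11WithDeriv.exists_contDiff_approx {n : ℕ}
    {f : EuclideanSpace ℝ (Fin n) → EuclideanSpace ℝ (Fin n)}
    {Df : EuclideanSpace ℝ (Fin n) → EuclideanSpace ℝ (Fin n) →L[ℝ] EuclideanSpace ℝ (Fin n)}
    {Ω : Set (EuclideanSpace ℝ (Fin n))} (hf : IsW11WithDeriv f Df Ω) (hΩ : MeasurableSet Ω)
    (hc : ContinuousOn f Ω) {x₀ : EuclideanSpace ℝ (Fin n)} {R R' : ℝ} (hR : R < R')
    (hx : Metric.closedBall x₀ R' ⊆ Ω) {p : ℝ} (hp : 1 ≤ p) {δ : ℝ} (hδ : 0 < δ) :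
    ∃ g : EuclideanSpace ℝ (Fin n) → EuclideanSpace ℝ (Fin n), ContDiff ℝ 1 g ∧
      (∀ x ∈ Metric.closedBall x₀ R, dist (g x) (f x) ≤ δ) ∧
      ∫⁻ x in Metric.ball x₀ R, ‖fderiv ℝ g x‖ₑ ^ p ≤
        ∫⁻ x in Metric.ball x₀ R', ‖Df x‖ₑ ^ p := by
  have huc : UniformContinuousOn f (Metric.closedBall x₀ R') :=
    (isCompact_closedBall x₀ R').uniformContinuousOn_of_continuous (hc.mono hx)
  obtain ⟨ε, hε, hεf⟩ := Metric.uniformContinuousOn_iff.1 huc δ hδ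
  set η := min ε (R' - R) with hη
  have hη0 : 0 < η := lt_min hε (by linarith)
  let φ : ContDiffBump (0 : EuclideanSpace ℝ (Fin n)) := ⟨η / 2, η, by positivity, by linarith⟩
  have hφr : φ.rOut = η := rfl
  have hηR : R + η ≤ R' := by linarith [min_le_right ε (R' - R)]
  have hint : Integrable (Ω.indicator f) := hf.integrable.integrable_indicator hΩ
  refine ⟨convolution (φ.normed volume) (Ω.indicator f)
      (ContinuousLinearMap.lsmul ℝ ℝ) volume, ?_, ?_, ?_⟩
  · exact φ.hasCompactSupport_normed.contDiff_convolution_left (n := 1) _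
      φ.contDiff_normed hint.locallyIntegrable
  · intro x hxR
    have hxR' : x ∈ Metric.closedBall x₀ R' := Metric.closedBall_subset_closedBall hR.le hxR
    have := ContDiffBump.dist_normed_convolution_le (μ := volume) (φ := φ) (x₀ := x) (ε := δ)
      (g := Ω.indicator f) hint.aestronglyMeasurable ?_
    · rwa [indicator_of_mem (hx hxR')] at this
    · intro y hy
      rw [hφr, Metric.mem_ball] at hy
      have hyR' : y ∈ Metric.closedBall x₀ R' := by
        rw [Metric.mem_closedBall] at hxR ⊢
        linarith [dist_triangle y x x₀]
      rw [indicator_of_mem (hx hxR'), indicator_of_mem (hx hyR')]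
      exact (hεf y hyR' x hxR' (hy.trans_le (min_le_left _ _))).le
  · refine (hf.lintegral_fderiv_convolution_rpow_le hΩ φ ?_ hp).trans ?_
    · exact (Metric.closedBall_subset_closedBall hηR).trans hx
    · exact lintegral_mono_set (Metric.ball_subset_ball hηR)

/-! ### Monotone maps -/

/-- Differences of values of a monotone function in a ball are dominated by differences of values on
the boundary sphere. -/
theorem LebesgueMonotoneOn.exists_mem_sphere {n : ℕ} {u : EuclideanSpace ℝ (Fin n) → ℝ}
    {Ω : Set (EuclideanSpace ℝ (Fin n))} (hu : LebesgueMonotoneOn u Ω) (hc : ContinuousOn u Ω)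
    {x : EuclideanSpace ℝ (Fin n)} {t : ℝ} (ht : 0 < t) (hx : Metric.closedBall x t ⊆ Ω)
    {y z : EuclideanSpace ℝ (Fin n)} (hy : y ∈ Metric.ball x t) (hz : z ∈ Metric.ball x t) :
    ∃ y' ∈ Metric.sphere x t, ∃ z' ∈ Metric.sphere x t, u y - u z ≤ u y' - u z' := by
  obtain ⟨hsup, hinf⟩ := hu x t ht hx
  -- The supremum over an empty sphere would be `⊥`, but the ball contains `y`.
  have hne : (Metric.sphere x t).Nonempty := by
    by_contra hne
    rw [not_nonempty_iff_eq_empty] at hne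
    rw [hne] at hsup
    have h1 : (u y : EReal) ≤ ⨆ y ∈ Metric.ball x t, (u y : EReal) :=
      le_iSup₂ (f := fun y (_ : y ∈ Metric.ball x t) => (u y : EReal)) y hy
    rw [← hsup] at h1
    simp at h1
  have hcs : ContinuousOn u (Metric.sphere x t) :=
    hc.mono (Metric.sphere_subset_closedBall.trans hx)
  obtain ⟨y', hy', hmax⟩ := (isCompact_sphere x t).exists_isMaxOn hne hcs
  obtain ⟨z', hz', hmin⟩ := (isCompact_sphere x t).exists_isMinOn hne hcs
  refine ⟨y', hy', z', hz', ?_⟩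
  have hmax' : ∀ w ∈ Metric.sphere x t, u w ≤ u y' := fun w hw => hmax hw
  have hmin' : ∀ w ∈ Metric.sphere x t, u z' ≤ u w := fun w hw => hmin hw
  have h1 : (u y : EReal) ≤ u y' := by
    have h1 : (u y : EReal) ≤ ⨆ y ∈ Metric.ball x t, (u y : EReal) :=
      le_iSup₂ (f := fun y (_ : y ∈ Metric.ball x t) => (u y : EReal)) y hy
    rw [← hsup] at h1
    exact h1.trans (iSup₂_le fun w hw => EReal.coe_le_coe_iff.2 (hmax' w hw))
  have h2 : (u z' : EReal) ≤ u z := by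
    have h2 : ⨅ y ∈ Metric.ball x t, (u y : EReal) ≤ (u z : EReal) :=
      iInf₂_le (f := fun y (_ : y ∈ Metric.ball x t) => (u y : EReal)) z hz
    rw [← hinf] at h2
    exact le_trans (le_iInf₂ fun w hw => EReal.coe_le_coe_iff.2 (hmin' w hw)) h2
  rw [EReal.coe_le_coe_iff] at h1 h2
  linarith

theorem MapLebesgueMonotoneOn.exists_mem_sphere {n : ℕ}
    {f : EuclideanSpace ℝ (Fin n) → EuclideanSpace ℝ (Fin n)}
    {Ω : Set (EuclideanSpace ℝ (Fin n))} (hf : MapLebesgueMonotoneOn f Ω) (hc : ContinuousOn f Ω)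
    {x : EuclideanSpace ℝ (Fin n)} {t : ℝ} (ht : 0 < t) (hx : Metric.closedBall x t ⊆ Ω)
    {y z : EuclideanSpace ℝ (Fin n)} (hy : y ∈ Metric.ball x t) (hz : z ∈ Metric.ball x t)
    (i : Fin n) :
    ∃ y' ∈ Metric.sphere x t, ∃ z' ∈ Metric.sphere x t, f y i - f z i ≤ ‖f y' - f z'‖ := by
  have hci : ContinuousOn (fun x => f x i) Ω :=
    (EuclideanSpace.proj (𝕜 := ℝ) i).continuous.comp_continuousOn hc
  obtain ⟨y', hy', z', hz', h⟩ := (hf i).exists_mem_sphere hci ht hx hy hz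
  refine ⟨y', hy', z', hz', h.trans ?_⟩
  refine le_trans ?_ (PiLp.norm_apply_le (f y' - f z') i)
  simpa using le_abs_self (f y' i - f z' i)

theorem EuclideanSpace.norm_le_card_mul {n : ℕ} {x : EuclideanSpace ℝ (Fin n)} {D : ℝ}
    (h : ∀ i, |x i| ≤ D) : ‖x‖ ≤ n * D := by
  have h1 := (EuclideanSpace.basisFun (Fin n) ℝ).sum_repr x
  calc ‖x‖ = ‖∑ i, (EuclideanSpace.basisFun (Fin n) ℝ).repr x i •
        EuclideanSpace.basisFun (Fin n) ℝ i‖ := by rw [h1]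
    _ ≤ ∑ i : Fin n, D := by
        refine (norm_sum_le _ _).trans (Finset.sum_le_sum fun i _ => ?_)
        rw [norm_smul, OrthonormalBasis.norm_eq_one, mul_one]
        simpa using h i
    _ = n * D := by simp

/-- The diameter of the image of a ball is controlled by bounds for the differences of each
component. -/
theorem diam_image_ball_le {n : ℕ} {f : EuclideanSpace ℝ (Fin n) → EuclideanSpace ℝ (Fin n)}
    {x : EuclideanSpace ℝ (Fin n)} {r : ℝ} {X : ℝ≥0∞}
    (h : ∀ y ∈ Metric.ball x r, ∀ z ∈ Metric.ball x r, ∀ i,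
      ENNReal.ofReal (f y i - f z i) ≤ X) :
    ENNReal.ofReal (Metric.diam (f '' Metric.ball x r)) ≤ n * X := by
  rcases eq_or_ne n 0 with rfl | hn
  · have : Metric.diam (f '' Metric.ball x r) = 0 :=
      Metric.diam_subsingleton (Set.subsingleton_of_subsingleton)
    simp [this]
  rcases eq_or_ne X ⊤ with rfl | hX
  · rw [ENNReal.mul_top (by exact_mod_cast hn)]; exact le_top
  have hb : Metric.diam (f '' Metric.ball x r) ≤ n * X.toReal := by
    refine Metric.diam_le_of_forall_dist_le (by positivity) ?_
    rintro _ ⟨y, hy, rfl⟩ _ ⟨z, hz, rfl⟩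
    rw [dist_eq_norm]
    refine EuclideanSpace.norm_le_card_mul fun i => ?_
    have h1 := (ENNReal.ofReal_le_iff_le_toReal hX).1 (h y hy z hz i)
    have h2 := (ENNReal.ofReal_le_iff_le_toReal hX).1 (h z hz y hy i)
    simp only [PiLp.sub_apply, abs_le]
    constructor <;> linarith
  refine (ENNReal.ofReal_le_ofReal hb).trans (le_of_eq ?_)
  rw [ENNReal.ofReal_mul (by positivity), ENNReal.ofReal_toReal hX, ENNReal.ofReal_natCast]

/-- An error term in a real difference may be sent to zero; the bound `X` may be infinite. -/
theorem ENNReal.ofReal_le_of_forall_sub_le {d : ℝ} {X : ℝ≥0∞}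
    (h : ∀ δ : ℝ, 0 < δ → ENNReal.ofReal (d - δ) ≤ X) : ENNReal.ofReal d ≤ X := by
  rcases eq_or_ne X ⊤ with rfl | hX
  · exact le_top
  rw [ENNReal.ofReal_le_iff_le_toReal hX]
  by_contra! hlt
  have := (ENNReal.ofReal_le_iff_le_toReal hX).1 (h ((d - X.toReal) / 2) (by linarith))
  linarith

/-- The basic oscillation estimate for monotone maps in `W^{1,p}` with `p > n - 1`. -/
theorem exists_ofReal_sub_rpow_le {n : ℕ} (hn : 2 ≤ n) {p : ℝ} (hp : (n : ℝ) - 1 < p) :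
    ∃ K : ℝ≥0∞, K ≠ ⊤ ∧ ∀ (f : EuclideanSpace ℝ (Fin n) → EuclideanSpace ℝ (Fin n))
      (Df : EuclideanSpace ℝ (Fin n) → EuclideanSpace ℝ (Fin n) →L[ℝ] EuclideanSpace ℝ (Fin n))
      (Ω : Set (EuclideanSpace ℝ (Fin n))), MeasurableSet Ω → ContinuousOn f Ω →
      MapLebesgueMonotoneOn f Ω → IsW11WithDeriv f Df Ω →
      ∀ (x₀ : EuclideanSpace ℝ (Fin n)) (r : ℝ), 0 < r → Metric.closedBall x₀ (3 * r) ⊆ Ω →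
      ∀ y ∈ Metric.ball x₀ r, ∀ z ∈ Metric.ball x₀ r, ∀ i,
      ENNReal.ofReal (f y i - f z i) ^ p ≤ K * ENNReal.ofReal (r ^ p * (r ^ n)⁻¹) *
        ∫⁻ x in Metric.ball x₀ (3 * r), ‖Df x‖ₑ ^ p := by
  have hn' : (2 : ℝ) ≤ n := by exact_mod_cast hn
  have hp1 : 1 ≤ p := by linarith
  have hp0 : 0 < p := by linarith
  obtain ⟨K, hK, hKb⟩ := exists_rpow_le_lintegral_of_forall_sphere hn hp
  refine ⟨K, hK, fun f Df Ω hΩ hc hmono hf x₀ r hr hx y hy z hz i => ?_⟩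
  set Y := K * ENNReal.ofReal (r ^ p * (r ^ n)⁻¹) * ∫⁻ x in Metric.ball x₀ (3 * r), ‖Df x‖ₑ ^ p
    with hY
  suffices h : ENNReal.ofReal (f y i - f z i) ≤ Y ^ (1 / p) by
    calc ENNReal.ofReal (f y i - f z i) ^ p ≤ (Y ^ (1 / p)) ^ p := by gcongr
      _ = Y := by rw [← ENNReal.rpow_mul, one_div_mul_cancel hp0.ne', ENNReal.rpow_one]
  refine ENNReal.ofReal_le_of_forall_sub_le fun δ hδ => ?_
  obtain ⟨g, hg, hgf, hgp⟩ := hf.exists_contDiff_approx hΩ hc (R := 2 * r) (R' := 3 * r)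
    (by linarith) hx hp1 (half_pos hδ)
  have hosc := hKb g hg x₀ r (ENNReal.ofReal (f y i - f z i - δ)) hr ?_
  · calc ENNReal.ofReal (f y i - f z i - δ)
        = (ENNReal.ofReal (f y i - f z i - δ) ^ p) ^ (1 / p) := by
          rw [← ENNReal.rpow_mul, mul_one_div_cancel hp0.ne', ENNReal.rpow_one]
      _ ≤ Y ^ (1 / p) := by
          gcongr
          refine hosc.trans ?_
          rw [hY]
          gcongr
  · intro t ht
    have ht0 : 0 < t := hr.trans ht.1
    have hrt := Metric.ball_subset_ball (x := x₀) ht.1.le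
    obtain ⟨y', hy', z', hz', hle⟩ := hmono.exists_mem_sphere hc ht0
      ((Metric.closedBall_subset_closedBall (by linarith [ht.2])).trans hx) (hrt hy) (hrt hz) i
    have hsph : ∀ w ∈ Metric.sphere x₀ t,
        ‖t⁻¹ • (w - x₀)‖ = 1 ∧ x₀ + t • t⁻¹ • (w - x₀) = w := by
      intro w hw
      rw [mem_sphere_iff_norm] at hw
      constructor
      · rw [norm_smul, hw, norm_inv, Real.norm_of_nonneg ht0.le, inv_mul_cancel₀ ht0.ne']
      · rw [smul_smul, mul_inv_cancel₀ ht0.ne', one_smul, add_sub_cancel]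
    have hs2 : Metric.sphere x₀ t ⊆ Metric.closedBall x₀ (2 * r) :=
      Metric.sphere_subset_closedBall.trans (Metric.closedBall_subset_closedBall ht.2.le)
    refine ⟨t⁻¹ • (y' - x₀), t⁻¹ • (z' - x₀), (hsph y' hy').1, (hsph z' hz').1, ?_⟩
    rw [(hsph y' hy').2, (hsph z' hz').2, ← ofReal_norm]
    refine ENNReal.ofReal_le_ofReal ?_
    have h1 := hgf y' (hs2 hy')
    have h2 := hgf z' (hs2 hz')
    rw [← dist_eq_norm] at hle ⊢
    have h3 := dist_triangle4 (f y') (g y') (g z') (f z')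
    have h4 := dist_comm (f y') (g y')
    linarith

/-! ### The one-dimensional case -/

/-- The fundamental theorem of calculus on `EuclideanSpace ℝ (Fin 1)`, transported from `ℝ` by the
isometry that a one-element orthonormal basis provides. -/
theorem enorm_sub_le_lintegral_fderiv_of_dim_one
    {g : EuclideanSpace ℝ (Fin 1) → EuclideanSpace ℝ (Fin 1)} (hg : ContDiff ℝ 1 g)
    {x₀ y z : EuclideanSpace ℝ (Fin 1)} {t : ℝ} (hy : y ∈ Metric.closedBall x₀ t)
    (hz : z ∈ Metric.closedBall x₀ t) :
    ‖g y - g z‖ₑ ≤ ∫⁻ x in Metric.ball x₀ t, ‖fderiv ℝ g x‖ₑ := by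
  set b := OrthonormalBasis.singleton (Fin 1) ℝ with hb
  set e : ℝ ≃ₗᵢ[ℝ] EuclideanSpace ℝ (Fin 1) := b.repr with he
  have hmp : MeasurePreserving e := b.measurePreserving_repr
  obtain ⟨y, rfl⟩ := e.surjective y
  obtain ⟨z, rfl⟩ := e.surjective z
  obtain ⟨x₀, rfl⟩ := e.surjective x₀
  rw [Metric.mem_closedBall, e.dist_map] at hy hz
  wlog hyz : z ≤ y generalizing y z
  · rw [← edist_eq_enorm_sub, edist_comm, edist_eq_enorm_sub]
    exact this z y hz hy (le_of_not_ge hyz)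
  have hu : ContDiff ℝ 1 (fun s => g (e s)) := hg.comp e.contDiff
  have hpre : e ⁻¹' Metric.ball (e x₀) t = Metric.ball x₀ t := by
    ext s; simp
  calc ‖g (e y) - g (e z)‖ₑ ≤ ∫⁻ s in Icc z y, ‖deriv (fun s => g (e s)) s‖ₑ :=
        enorm_sub_le_lintegral_deriv_of_contDiffOn_Icc hu.contDiffOn hyz
    _ = ∫⁻ s in Ioo z y, ‖deriv (fun s => g (e s)) s‖ₑ := by rw [restrict_Ioo_eq_restrict_Icc]
    _ ≤ ∫⁻ s in Ioo z y, ‖fderiv ℝ g (e s)‖ₑ := by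
        refine lintegral_mono fun s => ?_
        have hd := (hg.differentiable one_ne_zero (e s)).hasFDerivAt.comp_hasDerivAt s
          (e.toContinuousLinearEquiv.hasFDerivAt (x := s)).hasDerivAt
        have hd' : deriv (fun s => g (e s)) s = fderiv ℝ g (e s) (e 1) := hd.deriv
        rw [hd', ← ofReal_norm, ← ofReal_norm]
        refine ENNReal.ofReal_le_ofReal ((ContinuousLinearMap.le_opNorm _ _).trans ?_)
        rw [e.norm_map, norm_one, mul_one]
    _ ≤ ∫⁻ s in Metric.ball x₀ t, ‖fderiv ℝ g (e s)‖ₑ := by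
        refine lintegral_mono_set fun s hs => ?_
        rw [Metric.mem_ball, Real.dist_eq, abs_lt]
        rw [Real.dist_eq, abs_le] at hy hz
        constructor <;> linarith [hs.1, hs.2]
    _ = ∫⁻ x in Metric.ball (e x₀) t, ‖fderiv ℝ g x‖ₑ := by
        rw [← hpre]
        exact hmp.setLIntegral_comp_preimage measurableSet_ball
          (hg.continuous_fderiv one_ne_zero).measurable.enorm

theorem ofReal_sub_le_lintegral_of_dim_one
    {f : EuclideanSpace ℝ (Fin 1) → EuclideanSpace ℝ (Fin 1)}
    {Df : EuclideanSpace ℝ (Fin 1) → EuclideanSpace ℝ (Fin 1) →L[ℝ] EuclideanSpace ℝ (Fin 1)}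
    {Ω : Set (EuclideanSpace ℝ (Fin 1))} (hΩ : MeasurableSet Ω) (hc : ContinuousOn f Ω)
    (hmono : MapLebesgueMonotoneOn f Ω) (hf : IsW11WithDeriv f Df Ω)
    {x₀ : EuclideanSpace ℝ (Fin 1)} {r : ℝ} (hx : Metric.closedBall x₀ r ⊆ Ω)
    {y z : EuclideanSpace ℝ (Fin 1)} (hy : y ∈ Metric.ball x₀ r) (hz : z ∈ Metric.ball x₀ r)
    (i : Fin 1) :
    ENNReal.ofReal (f y i - f z i) ≤ ∫⁻ x in Metric.ball x₀ r, ‖Df x‖ₑ := by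
  -- A slightly smaller concentric ball still contains `y` and `z` and leaves room to mollify.
  obtain ⟨t, ht1, ht2⟩ := exists_between (max_lt (Metric.mem_ball.1 hy) (Metric.mem_ball.1 hz))
  obtain ⟨hty, htz⟩ := max_lt_iff.1 ht1
  have ht0 : 0 < t := dist_nonneg.trans_lt hty
  refine ENNReal.ofReal_le_of_forall_sub_le fun δ hδ => ?_
  obtain ⟨g, hg, hgf, hgp⟩ := hf.exists_contDiff_approx hΩ hc ht2 hx le_rfl (half_pos hδ)
  obtain ⟨y', hy', z', hz', hle⟩ := hmono.exists_mem_sphere hc ht0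
    ((Metric.closedBall_subset_closedBall ht2.le).trans hx) (Metric.mem_ball.2 hty)
    (Metric.mem_ball.2 htz) i
  have hy'' := Metric.sphere_subset_closedBall hy'
  have hz'' := Metric.sphere_subset_closedBall hz'
  simp only [ENNReal.rpow_one] at hgp
  refine le_trans ?_ ((enorm_sub_le_lintegral_fderiv_of_dim_one hg hy'' hz'').trans hgp)
  rw [← ofReal_norm]
  refine ENNReal.ofReal_le_ofReal ?_
  have h1 := hgf y' hy''
  have h2 := hgf z' hz''
  rw [← dist_eq_norm] at hle ⊢
  have h3 := dist_triangle4 (f y') (g y') (g z') (f z')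
  have h4 := dist_comm (f y') (g y')
  linarith

/-- In dimension one the cubes centred at a point are its balls, so the Lebesgue differentiation
theorem bounds a function by its maximal function. -/
theorem ae_le_cubeMaximal_of_dim_one {Ω : Set (EuclideanSpace ℝ (Fin 1))} (hΩ : IsOpen Ω)
    {h : EuclideanSpace ℝ (Fin 1) → ℝ} (h0 : ∀ x, 0 ≤ h x) (hi : IntegrableOn h Ω) :
    ∀ᵐ x ∂(volume.restrict Ω),
      ENNReal.ofReal (h x) ≤ cubeMaximal Ω (fun y => ENNReal.ofReal (h y)) x := by
  have hint : Integrable (Ω.indicator h) := hi.integrable_indicator hΩ.measurableSet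
  rw [ae_restrict_iff' hΩ.measurableSet]
  filter_upwards [IsUnifLocDoublingMeasure.ae_tendsto_average volume hint.locallyIntegrable 1]
    with x hx hxΩ
  have hδ : Filter.Tendsto (fun δ : ℝ => δ) (nhdsWithin 0 (Ioi 0)) (nhdsWithin 0 (Ioi 0)) :=
    Filter.tendsto_id
  have hlim := hx (fun _ => x) (fun δ : ℝ => δ) hδ (by
    filter_upwards [self_mem_nhdsWithin] with δ hδ
    rw [one_mul]
    exact Metric.mem_closedBall_self (le_of_lt hδ))
  rw [indicator_of_mem hxΩ] at hlim
  refine le_of_tendsto (ENNReal.tendsto_ofReal hlim) ?_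
  obtain ⟨ε, hε, hεΩ⟩ := Metric.nhds_basis_closedBall.mem_iff.1 (hΩ.mem_nhds hxΩ)
  filter_upwards [Ioc_mem_nhdsGT hε] with δ hδ
  have hball : Metric.closedBall x δ ⊆ Ω := (Metric.closedBall_subset_closedBall hδ.2).trans hεΩ
  have hcube : Metric.ball x δ = openCube (WithLp.toLp 2 fun i => x i - δ) (2 * δ) := by
    ext y
    rw [Metric.mem_ball, EuclideanSpace.dist_eq]
    simp only [Finset.univ_unique, Fin.default_eq_zero, Finset.sum_singleton, openCube,
      mem_ofPred_eq, Fin.forall_fin_one, Real.dist_eq, Real.sqrt_sq (abs_nonneg _), abs_lt]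
    constructor
    · rintro ⟨h1, h2⟩; constructor <;> linarith
    · rintro ⟨h1, h2⟩; constructor <;> linarith
  have hae : Metric.closedBall x δ =ᵐ[volume] Metric.ball x δ := by
    rw [← Metric.ball_union_sphere]
    exact union_ae_eq_left_of_ae_eq_empty (by
      rw [ae_eq_empty]; exact Measure.addHaar_sphere _ _ _)
  rw [ofReal_setAverage hint.integrableOn
    (Filter.Eventually.of_forall fun y => indicator_nonneg (fun y _ => h0 y) y),
    setLIntegral_congr hae, measure_congr hae, hcube, volume_openCube]
  rw [setLIntegral_congr_fun (g := fun y => ENNReal.ofReal (h y)) (isOpen_openCube _ _).measurableSet]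
  · refine le_cubeMaximal (by linarith [hδ.1]) ?_ ?_
    · rw [← hcube]; exact Metric.mem_ball_self hδ.1
    · rw [← hcube]; exact Metric.ball_subset_closedBall.trans hball
  · intro y hy
    rw [← hcube] at hy
    simp only [indicator_of_mem (hball (Metric.ball_subset_closedBall hy))]

/-! ### Pointwise estimate by the maximal function -/

theorem ofReal_norm_rpow {n : ℕ} {p : ℝ} (hp : 0 ≤ p)
    (L : EuclideanSpace ℝ (Fin n) →L[ℝ] EuclideanSpace ℝ (Fin n)) :
    ENNReal.ofReal (‖L‖ ^ p) = ‖L‖ₑ ^ p := by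
  rw [← ENNReal.ofReal_rpow_of_nonneg (norm_nonneg _) hp, ofReal_norm]

theorem openCube_subset_closedBall {n : ℕ} {x : EuclideanSpace ℝ (Fin n)} {r : ℝ} (hr : 0 < r) :
    openCube (WithLp.toLp 2 fun i => x i - 3 * r) (6 * r) ⊆
      Metric.closedBall x (4 * Real.sqrt n * r) := by
  intro y hy
  rw [Metric.mem_closedBall, EuclideanSpace.dist_eq]
  refine Real.sqrt_le_iff.2 ⟨by positivity, ?_⟩
  calc ∑ i, dist (y i) (x i) ^ 2 ≤ ∑ _i : Fin n, (3 * r) ^ 2 := by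
        refine Finset.sum_le_sum fun i _ => ?_
        refine pow_le_pow_left₀ dist_nonneg ?_ 2
        have := hy i
        simp only at this
        rw [Real.dist_eq, abs_le]
        constructor <;> linarith
    _ = n * (3 * r) ^ 2 := by simp
    _ ≤ (4 * Real.sqrt n * r) ^ 2 := by
        rw [mul_pow, mul_pow, mul_pow 4 (Real.sqrt n), Real.sq_sqrt (by positivity)]
        nlinarith [mul_nonneg (Nat.cast_nonneg (α := ℝ) n) (sq_nonneg r)]

theorem ball_subset_openCube {n : ℕ} (x : EuclideanSpace ℝ (Fin n)) (r : ℝ) :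
    Metric.ball x (3 * r) ⊆ openCube (WithLp.toLp 2 fun i => x i - 3 * r) (6 * r) := by
  intro y hy i
  rw [mem_ball_iff_norm] at hy
  have h1 := (PiLp.norm_apply_le (y - x) i).trans_lt hy
  rw [PiLp.sub_apply, Real.norm_eq_abs, abs_lt] at h1
  simp only
  constructor <;> linarith

/-- The radius `3 r` leaves room for spheres of radius up to `2 r` and for mollification. -/
theorem closedBall_subset_of_closedBall_sqrt {n : ℕ} (hn : 1 ≤ n)
    {Ω : Set (EuclideanSpace ℝ (Fin n))} {x : EuclideanSpace ℝ (Fin n)} {r : ℝ} (hr : 0 < r)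
    (hx : Metric.closedBall x (4 * Real.sqrt n * r) ⊆ Ω) : Metric.closedBall x (3 * r) ⊆ Ω := by
  refine (Metric.closedBall_subset_closedBall ?_).trans hx
  have : 1 ≤ Real.sqrt n := Real.one_le_sqrt.2 (by exact_mod_cast hn)
  nlinarith

/-- The diameter estimate in dimension at least two: all points of `B(x₀, r)` lie in one cube on
which the mean of `‖Df‖ ^ p` controls the oscillation, so their maximal functions do too. -/
theorem exists_diam_pow_le_of_two_le {n : ℕ} (hn : 2 ≤ n) {p : ℝ} (hp : (n : ℝ) - 1 < p) :
    ∃ C : ℝ, 0 < C ∧ ∀ (f : EuclideanSpace ℝ (Fin n) → EuclideanSpace ℝ (Fin n))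
      (Df : EuclideanSpace ℝ (Fin n) → EuclideanSpace ℝ (Fin n) →L[ℝ] EuclideanSpace ℝ (Fin n))
      (Ω : Set (EuclideanSpace ℝ (Fin n))), MeasurableSet Ω → ContinuousOn f Ω →
      MapLebesgueMonotoneOn f Ω → IsW11WithDeriv f Df Ω →
      ∀ (x₀ : EuclideanSpace ℝ (Fin n)) (r : ℝ), 0 < r →
      Metric.closedBall x₀ (4 * Real.sqrt n * r) ⊆ Ω →
      ENNReal.ofReal (Metric.diam (f '' Metric.ball x₀ r)) ^ n ≤ ENNReal.ofReal C *
        ∫⁻ y in Metric.ball x₀ r,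
          cubeMaximal Ω (fun y => ENNReal.ofReal (‖Df y‖ ^ p)) y ^ ((n : ℝ) / p) := by
  have hn' : (2 : ℝ) ≤ n := by exact_mod_cast hn
  have hp0 : 0 < p := by linarith
  have hq0 : 0 < n / p := by positivity
  obtain ⟨K, hK, hKb⟩ := exists_ofReal_sub_rpow_le hn hp
  set v : ℝ≥0∞ := volume (Metric.ball (0 : EuclideanSpace ℝ (Fin n)) 1) with hv
  have hvt : v ≠ ⊤ := measure_ball_lt_top.ne
  have hv0 : v ≠ 0 := (Metric.measure_ball_pos _ _ one_pos).ne'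
  -- `n ^ n` comes from passing to components, `6 ^ n` from the cube of side `6 r`.
  set C' : ℝ≥0∞ := (n : ℝ≥0∞) ^ n * (K * 6 ^ n) ^ (n / p) / v with hC'
  have hC't : C' ≠ ⊤ := by
    refine ENNReal.div_ne_top (ENNReal.mul_ne_top (by simp) ?_) hv0
    exact ENNReal.rpow_ne_top_of_nonneg hq0.le (ENNReal.mul_ne_top hK (by simp))
  refine ⟨C'.toReal + 1, by positivity, fun f Df Ω hΩ hc hmono hf x₀ r hr hx => ?_⟩
  have hC'le : C' ≤ ENNReal.ofReal (C'.toReal + 1) := by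
    rw [← ENNReal.ofReal_toReal hC't]
    exact ENNReal.ofReal_le_ofReal (by rw [ENNReal.toReal_ofReal (by positivity)]; linarith)
  set M := cubeMaximal Ω (fun y => ENNReal.ofReal (‖Df y‖ ^ p)) with hM
  have h3r := closedBall_subset_of_closedBall_sqrt (by omega) hr hx
  have : Nonempty (Fin n) := ⟨⟨0, by omega⟩⟩
  have hr0 : ENNReal.ofReal r ≠ 0 := by simpa using hr
  have hpow : (ENNReal.ofReal r ^ p) ^ (n / p) = ENNReal.ofReal r ^ n := by
    rw [← ENNReal.rpow_mul, mul_div_cancel₀ _ hp0.ne', ENNReal.rpow_natCast]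
  have hmax : ∀ y ∈ Metric.ball x₀ r,
      K * ENNReal.ofReal (r ^ p * (r ^ n)⁻¹) * ∫⁻ x in Metric.ball x₀ (3 * r), ‖Df x‖ₑ ^ p ≤
        K * 6 ^ n * ENNReal.ofReal r ^ p * M y := by
    intro y hy
    have h1 := le_cubeMaximal (Ω := Ω) (h := fun y => ENNReal.ofReal (‖Df y‖ ^ p))
      (t := 6 * r) (by positivity) (ball_subset_openCube x₀ r
        (Metric.ball_subset_ball (by linarith) hy)) ((openCube_subset_closedBall hr).trans hx)
    calc K * ENNReal.ofReal (r ^ p * (r ^ n)⁻¹) * ∫⁻ x in Metric.ball x₀ (3 * r), ‖Df x‖ₑ ^ p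
        ≤ K * ENNReal.ofReal (r ^ p * (r ^ n)⁻¹) *
          ∫⁻ x in openCube (WithLp.toLp 2 fun i => x₀ i - 3 * r) (6 * r),
            ENNReal.ofReal (‖Df x‖ ^ p) := by
          simp_rw [ofReal_norm_rpow hp0.le]
          gcongr
          exact ball_subset_openCube x₀ r
      _ = K * 6 ^ n * ENNReal.ofReal r ^ p *
          ((∫⁻ x in openCube (WithLp.toLp 2 fun i => x₀ i - 3 * r) (6 * r),
            ENNReal.ofReal (‖Df x‖ ^ p)) / ENNReal.ofReal (6 * r) ^ n) := by
          have e : ENNReal.ofReal (r ^ p * (r ^ n)⁻¹) =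
              6 ^ n * ENNReal.ofReal r ^ p * (ENNReal.ofReal (6 * r) ^ n)⁻¹ := by
            have h6 : (6 : ℝ≥0∞) ^ n = ENNReal.ofReal (6 ^ n) := by
              rw [ENNReal.ofReal_pow (by norm_num)]; simp
            rw [h6, ENNReal.ofReal_rpow_of_pos hr, ← ENNReal.ofReal_pow (by positivity),
              ← ENNReal.ofReal_inv_of_pos (by positivity), ← ENNReal.ofReal_mul (by positivity),
              ← ENNReal.ofReal_mul (by positivity)]
            congr 1
            rw [mul_pow]
            field_simp
          rw [e, div_eq_mul_inv]
          ring
      _ ≤ _ := by gcongr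
  have hdiam : ∀ y ∈ Metric.ball x₀ r, ENNReal.ofReal (Metric.diam (f '' Metric.ball x₀ r)) ^ n ≤
      (n : ℝ≥0∞) ^ n * (K * 6 ^ n) ^ (n / p) * ENNReal.ofReal r ^ n * M y ^ (n / p) := by
    intro y hy
    have h1 : ENNReal.ofReal (Metric.diam (f '' Metric.ball x₀ r)) ≤
        n * (K * 6 ^ n * ENNReal.ofReal r ^ p * M y) ^ (1 / p) := by
      refine diam_image_ball_le fun y' hy' z' hz' i => ?_
      have h2 := (hKb f Df Ω hΩ hc hmono hf x₀ r hr h3r y' hy' z' hz' i).trans (hmax y hy)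
      calc ENNReal.ofReal (f y' i - f z' i)
          = (ENNReal.ofReal (f y' i - f z' i) ^ p) ^ (1 / p) := by
            rw [← ENNReal.rpow_mul, mul_one_div_cancel hp0.ne', ENNReal.rpow_one]
        _ ≤ _ := by gcongr
    calc ENNReal.ofReal (Metric.diam (f '' Metric.ball x₀ r)) ^ n
        ≤ (n * (K * 6 ^ n * ENNReal.ofReal r ^ p * M y) ^ (1 / p)) ^ n := by gcongr
      _ = n ^ n * (K * 6 ^ n * ENNReal.ofReal r ^ p * M y) ^ (n / p) := by
          rw [mul_pow, ← ENNReal.rpow_natCast ((K * 6 ^ n * ENNReal.ofReal r ^ p * M y) ^ (1 / p)),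
            ← ENNReal.rpow_mul, one_div_mul_eq_div]
      _ = _ := by
          rw [ENNReal.mul_rpow_of_nonneg _ _ hq0.le, ENNReal.mul_rpow_of_nonneg _ _ hq0.le, hpow]
          ring
  have hvol : volume (Metric.ball x₀ r) = ENNReal.ofReal r ^ n * v := by
    rw [Measure.addHaar_ball _ _ hr.le, finrank_euclideanSpace_fin, ENNReal.ofReal_pow hr.le]
  have hS : v * ENNReal.ofReal r ^ n ≠ 0 := mul_ne_zero hv0 (by positivity)
  have hSt : v * ENNReal.ofReal r ^ n ≠ ⊤ := ENNReal.mul_ne_top hvt (by simp)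
  rw [← ENNReal.mul_le_mul_iff_right hS hSt]
  calc v * ENNReal.ofReal r ^ n * ENNReal.ofReal (Metric.diam (f '' Metric.ball x₀ r)) ^ n
      = ∫⁻ y in Metric.ball x₀ r, ENNReal.ofReal (Metric.diam (f '' Metric.ball x₀ r)) ^ n := by
        rw [setLIntegral_const, hvol]; ring
    _ ≤ ∫⁻ y in Metric.ball x₀ r,
          (n : ℝ≥0∞) ^ n * (K * 6 ^ n) ^ (n / p) * ENNReal.ofReal r ^ n * M y ^ (n / p) :=
        setLIntegral_mono' measurableSet_ball hdiam
    _ = v * ENNReal.ofReal r ^ n * (C' * ∫⁻ y in Metric.ball x₀ r, M y ^ (n / p)) := by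
        rw [lintegral_const_mul _ ((measurable_cubeMaximal _ _).pow_const _)]
        have : (n : ℝ≥0∞) ^ n * (K * 6 ^ n) ^ (n / p) = v * C' := by
          rw [hC', ENNReal.mul_div_cancel hv0 hvt]
        rw [this]
        ring
    _ ≤ _ := by gcongr

/-- The diameter estimate on the line, where it holds with constant one. -/
theorem diam_le_of_dim_one {p : ℝ} (hp : 0 < p)
    {f : EuclideanSpace ℝ (Fin 1) → EuclideanSpace ℝ (Fin 1)}
    {Df : EuclideanSpace ℝ (Fin 1) → EuclideanSpace ℝ (Fin 1) →L[ℝ] EuclideanSpace ℝ (Fin 1)}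
    {Ω : Set (EuclideanSpace ℝ (Fin 1))} (hΩ : IsOpen Ω) (hc : ContinuousOn f Ω)
    (hmono : MapLebesgueMonotoneOn f Ω) (hf : IsW11WithDeriv f Df Ω)
    (hi : IntegrableOn (fun x => ‖Df x‖ ^ p) Ω)
    {x₀ : EuclideanSpace ℝ (Fin 1)} {r : ℝ} (hx : Metric.closedBall x₀ r ⊆ Ω) :
    ENNReal.ofReal (Metric.diam (f '' Metric.ball x₀ r)) ≤
      ∫⁻ y in Metric.ball x₀ r,
        cubeMaximal Ω (fun y => ENNReal.ofReal (‖Df y‖ ^ p)) y ^ (1 / p) := by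
  have h1 := diam_image_ball_le (x := x₀) (r := r) fun y hy z hz i =>
    ofReal_sub_le_lintegral_of_dim_one hΩ.measurableSet hc hmono hf hx hy hz i
  rw [Nat.cast_one, one_mul] at h1
  refine h1.trans (lintegral_mono_ae ?_)
  have h2 := ae_le_cubeMaximal_of_dim_one hΩ (fun x => Real.rpow_nonneg (norm_nonneg (Df x)) p) hi
  filter_upwards [ae_restrict_of_ae_restrict_of_subset
    (Metric.ball_subset_closedBall.trans hx) h2] with y hy
  rw [ofReal_norm_rpow hp.le] at hy
  calc ‖Df y‖ₑ = (‖Df y‖ₑ ^ p) ^ (1 / p) := by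
        rw [← ENNReal.rpow_mul, mul_one_div_cancel hp.ne', ENNReal.rpow_one]
    _ ≤ _ := by gcongr

theorem exists_diam_pow_le {n : ℕ} (hn : 1 ≤ n) {p : ℝ} (hp : (n : ℝ) - 1 < p) :
    ∃ C : ℝ, 0 < C ∧ ∀ (f : EuclideanSpace ℝ (Fin n) → EuclideanSpace ℝ (Fin n))
      (Df : EuclideanSpace ℝ (Fin n) → EuclideanSpace ℝ (Fin n) →L[ℝ] EuclideanSpace ℝ (Fin n))
      (Ω : Set (EuclideanSpace ℝ (Fin n))), IsOpen Ω → ContinuousOn f Ω →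
      MapLebesgueMonotoneOn f Ω → IsW11WithDeriv f Df Ω →
      IntegrableOn (fun x => ‖Df x‖ ^ p) Ω →
      ∀ (x₀ : EuclideanSpace ℝ (Fin n)) (r : ℝ), 0 < r →
      Metric.closedBall x₀ (4 * Real.sqrt n * r) ⊆ Ω →
      ENNReal.ofReal (Metric.diam (f '' Metric.ball x₀ r)) ^ n ≤ ENNReal.ofReal C *
        ∫⁻ y in Metric.ball x₀ r,
          cubeMaximal Ω (fun y => ENNReal.ofReal (‖Df y‖ ^ p)) y ^ ((n : ℝ) / p) := by
  rcases eq_or_lt_of_le hn with rfl | hn2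
  · refine ⟨1, one_pos, fun f Df Ω hΩ hc hmono hf hi x₀ r hr hx => ?_⟩
    rw [pow_one, ENNReal.ofReal_one, one_mul, Nat.cast_one]
    refine diam_le_of_dim_one (by simpa using hp) hΩ hc hmono hf hi ?_
    exact (Metric.closedBall_subset_closedBall (by linarith)).trans
      (closedBall_subset_of_closedBall_sqrt hn hr hx)
  · obtain ⟨C, hC, h⟩ := exists_diam_pow_le_of_two_le hn2 hp
    exact ⟨C, hC, fun f Df Ω hΩ hc hmono hf _ x₀ r hr hx =>
      h f Df Ω hΩ.measurableSet hc hmono hf x₀ r hr hx⟩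

/-! ### Integrability of the dominating function -/

theorem log_add_mul_pow_le {n : ℕ} (hn : 1 ≤ n) {A X : ℝ} (hA : 0 ≤ A) (hX : 0 ≤ X) :
    Real.log (Real.exp 1 + A * X ^ n) ≤
      (Real.log (1 + A) + n) * Real.log (Real.exp 1 + X) := by
  have he : 1 ≤ Real.exp 1 := Real.one_le_exp zero_le_one
  have hlog : 1 ≤ Real.log (Real.exp 1 + X) := by
    rw [Real.le_log_iff_exp_le (by positivity)]; linarith
  have h1 : Real.exp 1 + A * X ^ n ≤ (1 + A) * (Real.exp 1 + X) ^ n := by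
    have h2 : Real.exp 1 + X ≤ (Real.exp 1 + X) ^ n := le_self_pow₀ (by linarith) (by omega)
    have h3 : X ^ n ≤ (Real.exp 1 + X) ^ n := pow_le_pow_left₀ hX (by linarith) n
    nlinarith [mul_le_mul_of_nonneg_left h3 hA]
  calc Real.log (Real.exp 1 + A * X ^ n) ≤ Real.log ((1 + A) * (Real.exp 1 + X) ^ n) :=
        Real.log_le_log (by positivity) h1
    _ = Real.log (1 + A) + n * Real.log (Real.exp 1 + X) := by
        rw [Real.log_mul (by positivity) (by positivity), Real.log_pow]
    _ ≤ _ := by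
        have : 0 ≤ Real.log (1 + A) := Real.log_nonneg (by linarith)
        nlinarith

/-- The Orlicz condition dominates `‖Df‖ ^ p`, because `t ^ p ≤ 1 + t ^ n` and the logarithm is at least
one. -/
theorem integrableOn_norm_rpow {n : ℕ} {p : ℝ} (hp0 : 0 < p) (hpn : p < n) {lam : ℝ}
    (hlam : 0 < lam) {Ω : Set (EuclideanSpace ℝ (Fin n))} (hΩ : volume Ω ≠ ⊤)
    {Df : EuclideanSpace ℝ (Fin n) → EuclideanSpace ℝ (Fin n) →L[ℝ] EuclideanSpace ℝ (Fin n)}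
    (hm : AEStronglyMeasurable Df (volume.restrict Ω))
    (hi : IntegrableOn (fun x => ‖Df x‖ ^ n * Real.log (Real.exp 1 + ‖Df x‖) ^ lam) Ω) :
    IntegrableOn (fun x => ‖Df x‖ ^ p) Ω := by
  have h1 : IntegrableOn (fun x =>
      1 + ‖Df x‖ ^ n * Real.log (Real.exp 1 + ‖Df x‖) ^ lam) Ω := (integrableOn_const hΩ).add hi
  refine h1.mono' ?_ (Filter.Eventually.of_forall fun x => ?_)
  · exact (hm.norm.aemeasurable.pow_const p).aestronglyMeasurable
  · have hX : 0 ≤ ‖Df x‖ := norm_nonneg _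
    rw [Real.norm_of_nonneg (Real.rpow_nonneg hX p)]
    have hlog : 1 ≤ Real.log (Real.exp 1 + ‖Df x‖) := by
      rw [Real.le_log_iff_exp_le (by positivity)]; linarith
    have hlog' : 1 ≤ Real.log (Real.exp 1 + ‖Df x‖) ^ lam := Real.one_le_rpow hlog hlam.le
    have h2 : ‖Df x‖ ^ n ≤ ‖Df x‖ ^ n * Real.log (Real.exp 1 + ‖Df x‖) ^ lam :=
      le_mul_of_one_le_right (by positivity) hlog'
    rcases le_total ‖Df x‖ 1 with h | h
    · have := Real.rpow_le_one hX h hp0.le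
      have : 0 ≤ ‖Df x‖ ^ n := by positivity
      linarith
    · have := Real.rpow_le_rpow_of_exponent_le h hpn.le
      rw [Real.rpow_natCast] at this
      linarith

/-- The strong type inequality with `Ψ s = log ^ lam (e + C s ^ (n / p))`. Since `(‖Df‖ ^ p) ^ (n / p)` is
`‖Df‖ ^ n`, the right side is comparable to `‖Df‖ ^ n log ^ lam (e + ‖Df‖)`. -/
theorem lintegral_cubeMaximal_mul_log_lt_top {n : ℕ} (hn : 1 ≤ n) {p : ℝ} (hp0 : 0 < p)
    (hpn : p < n) {lam : ℝ} (hlam : 0 < lam) {C : ℝ} (hC : 0 < C)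
    {Ω : Set (EuclideanSpace ℝ (Fin n))} (hΩ : volume Ω ≠ ⊤)
    {Df : EuclideanSpace ℝ (Fin n) → EuclideanSpace ℝ (Fin n) →L[ℝ] EuclideanSpace ℝ (Fin n)}
    (hm : AEStronglyMeasurable Df (volume.restrict Ω))
    (hi : IntegrableOn (fun x => ‖Df x‖ ^ n * Real.log (Real.exp 1 + ‖Df x‖) ^ lam) Ω) :
    (∀ᵐ x, cubeMaximal Ω (fun y => ENNReal.ofReal (‖Df y‖ ^ p)) x < ⊤) ∧
    ∫⁻ x in Ω, cubeMaximal Ω (fun y => ENNReal.ofReal (‖Df y‖ ^ p)) x ^ ((n : ℝ) / p) *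
      ENNReal.ofReal (Real.log (Real.exp 1 + C *
        (cubeMaximal Ω (fun y => ENNReal.ofReal (‖Df y‖ ^ p)) x).toReal ^ ((n : ℝ) / p)) ^ lam)
      < ⊤ := by
  have hn0 : n ≠ 0 := by omega
  have hq : 1 < n / p := by rw [one_lt_div hp0]; exact hpn
  have hq0 : 0 < n / p := by linarith
  have hip := integrableOn_norm_rpow hp0 hpn hlam hΩ hm hi
  have hhm : AEMeasurable (fun y => ENNReal.ofReal (‖Df y‖ ^ p)) (volume.restrict Ω) :=
    (hm.norm.aemeasurable.pow_const p).ennreal_ofReal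
  have hfin : ∫⁻ x in Ω, hhm.mk _ x ≠ ⊤ := by
    rw [← lintegral_congr_ae hhm.ae_eq_mk]
    exact hip.lintegral_lt_top.ne
  set Ψ : ℝ → ℝ≥0∞ := fun s =>
    ENNReal.ofReal (Real.log (Real.exp 1 + C * (max s 0) ^ (n / p)) ^ lam) with hΨ
  have he : 1 ≤ Real.exp 1 := Real.one_le_exp zero_le_one
  have hΨmono : Monotone Ψ := by
    intro s t hst
    refine ENNReal.ofReal_le_ofReal (Real.rpow_le_rpow (Real.log_nonneg ?_) ?_ hlam.le)
    · have : 0 ≤ C * (max s 0) ^ (n / p) := by positivity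
      linarith
    · refine Real.log_le_log (by positivity) ?_
      gcongr
  rw [cubeMaximal_congr hhm.ae_eq_mk]
  refine ⟨ae_cubeMaximal_lt_top hn0 hΩ hhm.measurable_mk hfin, ?_⟩
  have hstrong := lintegral_cubeMaximal_rpow_mul_le hn0 hΩ hhm.measurable_mk hfin hq hΨmono
  set A : ℝ := C * 4 ^ (n / p) with hA
  set B : ℝ := Real.log (1 + A) + n with hB
  have hA0 : 0 ≤ A := by positivity
  have hB0 : 0 ≤ B := add_nonneg (Real.log_nonneg (by linarith)) (by positivity)
  have hbound : ∫⁻ x in Ω, hhm.mk _ x ^ (n / p) * Ψ (4 * (hhm.mk _ x).toReal) ≤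
      ENNReal.ofReal (B ^ lam) * ∫⁻ x in Ω,
        ENNReal.ofReal (‖Df x‖ ^ n * Real.log (Real.exp 1 + ‖Df x‖) ^ lam) := by
    rw [← lintegral_const_mul' _ _ ENNReal.ofReal_ne_top]
    refine lintegral_mono_ae ?_
    filter_upwards [hhm.ae_eq_mk] with x hx
    rw [← hx]
    have hX : 0 ≤ ‖Df x‖ := norm_nonneg _
    have hXp : 0 ≤ ‖Df x‖ ^ p := Real.rpow_nonneg hX p
    have hXq : (‖Df x‖ ^ p) ^ (n / p) = ‖Df x‖ ^ n := by
      rw [← Real.rpow_mul hX, mul_div_cancel₀ _ hp0.ne', Real.rpow_natCast]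
    have hΨle : Ψ (4 * (ENNReal.ofReal (‖Df x‖ ^ p)).toReal) ≤
        ENNReal.ofReal (B ^ lam * Real.log (Real.exp 1 + ‖Df x‖) ^ lam) := by
      simp only [hΨ]
      refine ENNReal.ofReal_le_ofReal ?_
      rw [ENNReal.toReal_ofReal hXp, max_eq_left (by positivity),
        Real.mul_rpow (by norm_num) hXp, hXq, ← mul_assoc, ← hA,
        ← Real.mul_rpow hB0 (Real.log_nonneg (by linarith))]
      refine Real.rpow_le_rpow (Real.log_nonneg ?_) (log_add_mul_pow_le hn hA0 hX) hlam.le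
      have : 0 ≤ A * ‖Df x‖ ^ n := by positivity
      linarith
    rw [ENNReal.ofReal_rpow_of_nonneg hXp hq0.le, hXq]
    refine (mul_le_mul_right hΨle _).trans (le_of_eq ?_)
    rw [← ENNReal.ofReal_mul (by positivity), ← ENNReal.ofReal_mul (by positivity)]
    congr 1
    ring
  have hlt : ∫⁻ x in Ω, cubeMaximal Ω (hhm.mk _) x ^ (n / p) *
      Ψ (cubeMaximal Ω (hhm.mk _) x).toReal < ⊤ := by
    refine hstrong.trans_lt (ENNReal.mul_lt_top ENNReal.ofReal_lt_top (hbound.trans_lt ?_))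
    exact ENNReal.mul_lt_top ENNReal.ofReal_lt_top hi.lintegral_lt_top
  simpa only [hΨ, max_eq_left ENNReal.toReal_nonneg] using hlt

theorem proposition4p4 (n : ℕ) (hn : 1 ≤ n) (p : ℝ) (hp : (n : ℝ) - 1 < p) (hpn : p < n) :
    ∃ C : ℝ, 0 < C ∧
      ∀ (a : EuclideanSpace ℝ (Fin n)) (s : ℝ) (_ : 0 < s)
        (Ω : Set (EuclideanSpace ℝ (Fin n))) (_ : Ω = openCube a s)
        (f : EuclideanSpace ℝ (Fin n) → EuclideanSpace ℝ (Fin n))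
        (Df : EuclideanSpace ℝ (Fin n) → EuclideanSpace ℝ (Fin n) →L[ℝ] EuclideanSpace ℝ (Fin n))
        (lam : ℝ) (_ : 0 < lam)
        (_ : ContinuousOn f Ω) (_ : MapLebesgueMonotoneOn f Ω) (_ : IsW11WithDeriv f Df Ω)
        (_ : IntegrableOn (fun x => ‖Df x‖ ^ n * Real.log (Real.exp 1 + ‖Df x‖) ^ lam) Ω),
        ∃ ρ : EuclideanSpace ℝ (Fin n) → ℝ,
          (∀ x, 0 ≤ ρ x) ∧
          (∀ᵐ x ∂(volume.restrict Ω), ENNReal.ofReal (ρ x) =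
            ENNReal.ofReal C *
              cubeMaximal Ω (fun y => ENNReal.ofReal (‖Df y‖ ^ p)) x ^ ((n : ℝ) / p)) ∧
          IntegrableOn ρ Ω ∧
          IntegrableOn (fun x => ρ x * Real.log (Real.exp 1 + ρ x) ^ lam) Ω ∧
          ∀ x ∈ Ω, ∀ r : ℝ, 0 < r → Metric.closedBall x (4 * Real.sqrt n * r) ⊆ Ω →
            Metric.diam (f '' Metric.ball x r) ^ n ≤ ∫ y in Metric.ball x r, ρ y := by
  have hn' : (1 : ℝ) ≤ n := by exact_mod_cast hn
  have hp0 : 0 < p := by linarith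
  have hq0 : 0 < n / p := by positivity
  obtain ⟨C, hC, hdiam⟩ := exists_diam_pow_le hn hp
  refine ⟨C, hC, ?_⟩
  intro a s hs Ω hΩ f Df lam hlam hc hmono hf hi
  have hΩo : IsOpen Ω := hΩ ▸ isOpen_openCube a s
  have hΩt : volume Ω ≠ ⊤ := by rw [hΩ, volume_openCube]; simp
  have hm := hf.integrable_deriv.aestronglyMeasurable
  set M := cubeMaximal Ω (fun y => ENNReal.ofReal (‖Df y‖ ^ p)) with hM
  obtain ⟨hfin, hlt⟩ := lintegral_cubeMaximal_mul_log_lt_top hn hp0 hpn hlam hC hΩt hm hi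
  rw [← hM] at hfin hlt
  have hMm : Measurable M := measurable_cubeMaximal _ _
  set ρ : EuclideanSpace ℝ (Fin n) → ℝ := fun x => C * (M x).toReal ^ ((n : ℝ) / p) with hρ
  have hρ0 : ∀ x, 0 ≤ ρ x := fun x => by positivity
  have hρm : Measurable ρ := (hMm.ennreal_toReal.pow_const _).const_mul C
  have hMpow : ∀ x, M x < ⊤ →
      M x ^ ((n : ℝ) / p) = ENNReal.ofReal ((M x).toReal ^ ((n : ℝ) / p)) := fun x hx => by
    rw [← ENNReal.ofReal_rpow_of_nonneg ENNReal.toReal_nonneg hq0.le, ENNReal.ofReal_toReal hx.ne]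
  have hρM : ∀ x, M x < ⊤ →
      ENNReal.ofReal (ρ x) = ENNReal.ofReal C * M x ^ ((n : ℝ) / p) := fun x hx => by
    rw [hMpow x hx, ← ENNReal.ofReal_mul hC.le]
  have hlog : ∀ x, 1 ≤ Real.log (Real.exp 1 + ρ x) := fun x => by
    have := hρ0 x
    rw [Real.le_log_iff_exp_le (by positivity)]
    linarith
  have hpos : ∀ x, 0 ≤ ρ x * Real.log (Real.exp 1 + ρ x) ^ lam := fun x =>
    mul_nonneg (hρ0 x) (Real.rpow_nonneg (zero_le_one.trans (hlog x)) _)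
  have hint : IntegrableOn (fun x => ρ x * Real.log (Real.exp 1 + ρ x) ^ lam) Ω := by
    refine ⟨?_, ?_⟩
    · refine Measurable.aestronglyMeasurable ?_
      exact hρm.mul ((Real.measurable_log.comp (hρm.const_add _)).pow_const _)
    · rw [hasFiniteIntegral_iff_ofReal (Filter.Eventually.of_forall hpos)]
      refine lt_of_le_of_lt (le_of_eq ?_)
        (ENNReal.mul_lt_top (ENNReal.ofReal_lt_top (r := C)) hlt)
      rw [← lintegral_const_mul' _ _ ENNReal.ofReal_ne_top]
      refine lintegral_congr_ae ?_
      filter_upwards [ae_restrict_of_ae hfin] with x hx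
      rw [ENNReal.ofReal_mul (hρ0 x), hρM x hx, mul_assoc]
  have hintρ : IntegrableOn ρ Ω := by
    refine hint.mono' hρm.aestronglyMeasurable (Filter.Eventually.of_forall fun x => ?_)
    rw [Real.norm_of_nonneg (hρ0 x)]
    exact le_mul_of_one_le_right (hρ0 x) (Real.one_le_rpow (hlog x) hlam.le)
  refine ⟨ρ, hρ0, ?_, hintρ, hint, ?_⟩
  · filter_upwards [ae_restrict_of_ae hfin] with x hx using hρM x hx
  · intro x _ r hr hx
    have hball : Metric.ball x r ⊆ Ω :=
      (Metric.ball_subset_closedBall.trans (Metric.closedBall_subset_closedBall (by linarith))).trans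
        (closedBall_subset_of_closedBall_sqrt hn hr hx)
    have h1 := hdiam f Df Ω hΩo hc hmono hf (integrableOn_norm_rpow hp0 hpn hlam hΩt hm hi) x r hr hx
    rw [← ENNReal.ofReal_le_ofReal_iff (integral_nonneg hρ0),
      ofReal_integral_eq_lintegral_ofReal (hintρ.mono_set hball)
        (Filter.Eventually.of_forall hρ0), ENNReal.ofReal_pow Metric.diam_nonneg]
    refine h1.trans (le_of_eq ?_)
    rw [← lintegral_const_mul' _ _ ENNReal.ofReal_ne_top]
    refine lintegral_congr_ae ?_
    filter_upwards [ae_restrict_of_ae hfin] with y hy using (hρM y hy).symm
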